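/- **Setting.** Let $\mathfrak A$ be an additive category closed under finite limits and finite colimits, with a symmetric monoidal product $\otimes$ (unit $k$) that is additive in each variable and preserves cokernels in each variable. Fix a class $\mathfrak I$ of objects of $\mathfrak A$. A map $i:X\to Y$ is an *$\mathfrak I$-cofibration* if $\hom(Y,I)\to\hom(X,I)$ is surjective for all $I\in\mathfrak I$, and $F$ is *relatively injective* if $\hom(-,F)$ maps $\mathfrak I$-cofibrations to surjections. Assume that every object of $\mathfrak A$ is relatively injective. Let pro-$\mathfrak A$ be the category of inverse systems $X=\{X_{n+1}\to X_n\}_{n\ge1}$ in $\mathfrak A$ with $\hom(X,Y)=\lim_n\operatorname{colim}_m\hom(X_m,Y_n)$ and levelwise tensor product. A map $X\to Y$ in pro-$\mathfrak A$ is a *cofibration* if $\hom(Y,I)\to\hom(X,I)$ is surjective for every $I\in\mathfrak A$ (viewed as a constant pro-object), and $F\in$ pro-$\mathfrak A$ is *relatively injective* if $\hom(-,F)$ maps cofibrations to surjections. A chain complex $Q$ in pro-$\mathfrak A$ is *weakly contractible* if the complex $\operatorname{Hom}(Q,F)$ is exact for every relatively injective $F\in$ pro-$\mathfrak A$. An *algebra*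 is an object $R$ with an associative map $\mu:R\otimes R\to R$ (no unit is assumed), and $\tilde R=R\oplus k$. A *pro-algebra* is an inverse system $\{A_n\}_{n\ge1}$ of algebras in $\mathfrak A$; it is regarded as an algebra in pro-$\mathfrak A$. For an algebra $R$ in pro-$\mathfrak A$: * Let $\Omega^2R=\tilde R\otimes R\otimes R$ (where $r\otimes a\otimes b$ stands for $r\,da\,db$) with the $R$-bimodule structure $c\cdot(r\,da\,db)=cr\,da\,db$ and $(r\,da\,db)\cdot c=r\,da\,d(bc)-r\,d(ab)\,dc+ra\,db\,dc$. $R$ is *quasi-free* if the Hochschild $2$-cochain $d\cup d:R\otimes R\to\Omega^2R$, $a\otimes b\mapsto da\,db$, is a coboundary, i.e. there is a map $\varphi:R\to\Omega^2R$ in pro-$\mathfrak A$ with $a\varphi(b)-\varphi(ab)+\varphi(a)b=da\,db$. * $C^{bar}(R)$ is the complex with $R^{\otimes n+1}$ in degree $n\ge0$ and boundary $b'(a_0\otimes\dots\otimes a_n)=\sum_{i=0}^{n-1}(-1)^ia_0\otimes\dots\otimes a_ia_{i+1}\otimes\dots\otimes a_n$. $R$ is *$H$-unital* if $V\otimes C^{bar}(R)$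 is weakly contractible for every $V\in$ pro-$\mathfrak A$. A *pro-ideal* $K\triangleleft A$ of a pro-algebra is a sequence of two-sided ideals $K_n\triangleleft A_n$ (subobjects stable under left and right multiplication by $A_n$) compatible with the maps $A_{n+1}\to A_n$; it is a *cof-pro-ideal* if the inclusion $K\to A$ is a cofibration in pro-$\mathfrak A$. For an algebra $R$ in $\mathfrak A$, $R^n$ is the image (the cokernel of the kernel) of the $n$-fold multiplication $R^{\otimes n}\to R$, with the multiplication induced by that of $R$, and $K^\infty=\{K_n^n\}_{n\ge1}$ is the resulting pro-algebra. **Theorem 6.3.** Let $A$ be a quasi-free pro-algebra in $\mathfrak A$ and $K\rightarrowtail A$ a cof-pro-ideal. Then the pro-algebra $K^\infty$ is $H$-unital, and the inclusion $K^\infty\to K$ is a cofibration in pro-$\mathfrak A$. -/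

import Mathlib

open CategoryTheory CategoryTheory.Limits MonoidalCategory Opposite

universe v u

noncomputable section

namespace CQ

section BasicPairs

variable {C : Type u} [Category.{v} C]

/-- Given a class `J` of basic objects, a map `i : X ⟶ Y` is a cofibration if
`hom(i, I)` is surjective for all basic `I`. -/
def IsCofibration (J : ObjectProperty C) {X Y : C} (i : X ⟶ Y) : Prop :=
  ∀ I : C, J I → Function.Surjective (fun g : Y ⟶ I => i ≫ g)

/-- `F` is relatively injective if `hom(-, F)` maps cofibrations to surjections. -/
def RelativelyInjective (J : ObjectProperty C) : ObjectProperty C := fun F =>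
  ∀ ⦃X Y : C⦄ (i : X ⟶ Y), IsCofibration J i → Function.Surjective (fun g : Y ⟶ F => i ≫ g)

/-- A chain complex `Q` is weakly contractible if the complex `Hom(Q, F)` of abelian groups
is exact (in every degree) for every relatively injective object `F`.  For `n = 0` the
outgoing differential `Q.dFrom 0` is zero. -/
def IsWeaklyContractible [Preadditive C] (J : ObjectProperty C) (Q : ChainComplex C ℕ) : Prop :=
  ∀ F : C, RelativelyInjective J F → ∀ (n : ℕ) (x : Q.X n ⟶ F), Q.dTo n ≫ x = 0 →
    ∃ y : Q.xNext n ⟶ F, Q.dFrom n ≫ y = x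

end BasicPairs

section Pro

variable {C : Type u} [Category.{v} C] [Preadditive C]

/-- Inverse systems indexed by the positive integers. -/
abbrev Tower (C : Type u) [Category.{v} C] := ℕ+ᵒᵖ ⥤ C

/-- The transition map `hom(X_i, c) → hom(X_j, c)`, for `i ≤ j`. -/
def homTrans (X : Tower C) (c : C) (i j : ℕ+) (h : i ≤ j) :
    (X.obj (op i) ⟶ c) →+ (X.obj (op j) ⟶ c) :=
  Preadditive.leftComp c (X.map (homOfLE h).op)

lemma homTrans_apply (X : Tower C) (c : C) (i j : ℕ+) (h : i ≤ j) (f : X.obj (op i) ⟶ c) :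
    homTrans X c i j h f = X.map (homOfLE h).op ≫ f := rfl

instance (X : Tower C) (c : C) :
    DirectedSystem (fun i : ℕ+ => (X.obj (op i) ⟶ c)) (homTrans X c · · ·) where
  map_self i x := by
    change X.map (𝟙 (op i)) ≫ x = x
    simp
  map_map k j i hij hjk x := by
    simp only [homTrans_apply, ← Category.assoc, ← Functor.map_comp]
    rfl

/-- The abelian group `colim_m hom(X_m, c)`. -/
abbrev ColimHom (X : Tower C) (c : C) : Type v :=
  DirectLimit (fun i : ℕ+ => (X.obj (op i) ⟶ c)) (homTrans X c)

/-- The class of a map `X_i ⟶ c` in `colim_m hom(X_m, c)`. -/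
def ColimHom.mk {X : Tower C} {c : C} (i : ℕ+) (f : X.obj (op i) ⟶ c) : ColimHom X c := ⟦⟨i, f⟩⟧

lemma ColimHom.mk_trans {X : Tower C} {c : C} {i j : ℕ+} (h : i ≤ j) (f : X.obj (op i) ⟶ c) :
    ColimHom.mk j (X.map (homOfLE h).op ≫ f) = ColimHom.mk i f :=
  (DirectLimit.mk_apply (F := fun i : ℕ+ => (X.obj (op i) ⟶ c)) (f := homTrans X c) i j f h)

lemma ColimHom.ind {X : Tower C} {c : C} {P : ColimHom X c → Prop}
    (h : ∀ i f, P (ColimHom.mk i f)) (x) : P x :=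
  DirectLimit.induction _ h x

lemma ColimHom.mk_add {X : Tower C} {c : C} (i : ℕ+) (f g : X.obj (op i) ⟶ c) :
    ColimHom.mk i (f + g) = ColimHom.mk i f + ColimHom.mk i g :=
  (DirectLimit.add_def (G := fun i : ℕ+ => (X.obj (op i) ⟶ c)) (f := homTrans X c) i f g).symm

/-- Postcomposition with `g : c ⟶ d`, as a map `colim_m hom(X_m, c) → colim_m hom(X_m, d)`. -/
def ColimHom.push (X : Tower C) {c d : C} (g : c ⟶ d) : ColimHom X c →+ ColimHom X d :=
  AddMonoidHom.mk' (DirectLimit.lift _ (fun i f => ColimHom.mk i (f ≫ g)) (by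
    intro i j h f
    rw [homTrans_apply, Category.assoc, ColimHom.mk_trans])) (by
    apply DirectLimit.induction₂
    intro i f f'
    rw [DirectLimit.add_def]
    simp only [DirectLimit.lift_def, Preadditive.add_comp]
    exact ColimHom.mk_add ..)

lemma ColimHom.push_mk {X : Tower C} {c d : C} (g : c ⟶ d) (i : ℕ+) (f : X.obj (op i) ⟶ c) :
    ColimHom.push X g (ColimHom.mk i f) = ColimHom.mk i (f ≫ g) := rfl

lemma ColimHom.push_id {X : Tower C} {c : C} (x : ColimHom X c) :
    ColimHom.push X (𝟙 c) x = x := by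
  induction x using ColimHom.ind with
  | h i f => rw [push_mk, Category.comp_id]

lemma ColimHom.push_push {X : Tower C} {c d e : C} (g : c ⟶ d) (h : d ⟶ e) (x : ColimHom X c) :
    ColimHom.push X h (ColimHom.push X g x) = ColimHom.push X (g ≫ h) x := by
  induction x using ColimHom.ind with
  | h i f => simp only [push_mk, Category.assoc]

lemma ColimHom.push_add {X : Tower C} {c d : C} (g h : c ⟶ d) (x : ColimHom X c) :
    ColimHom.push X (g + h) x = ColimHom.push X g x + ColimHom.push X h x := by
  induction x using ColimHom.ind with
  | h i f => simp only [push_mk, Preadditive.comp_add, mk_add]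

/-- The abelian group `lim_n colim_m hom(X_m, Y_n)`, as a subgroup of the product over `n`. -/
def proHom (X Y : Tower C) : AddSubgroup (∀ n : ℕ+, ColimHom X (Y.obj (op n))) where
  carrier := {x | ∀ (m n : ℕ+) (h : m ≤ n), ColimHom.push X (Y.map (homOfLE h).op) (x n) = x m}
  add_mem' := by
    intro a b ha hb m n h
    simp only [Pi.add_apply, map_add, ha m n h, hb m n h]
  zero_mem' := by
    intro m n h
    simp only [Pi.zero_apply, map_zero]
  neg_mem' := by
    intro a ha m n h
    simp only [Pi.neg_apply, map_neg, ha m n h]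

/-- Precomposition with a pro-map. -/
def proPrecomp {X Y : Tower C} (f : proHom X Y) (c : C) : ColimHom Y c →+ ColimHom X c :=
  AddMonoidHom.mk' (DirectLimit.lift _ (fun n g => ColimHom.push X g (f.1 n)) (by
    intro i j h g
    rw [homTrans_apply, ← ColimHom.push_push, f.2 i j h])) (by
    apply DirectLimit.induction₂
    intro i g g'
    rw [DirectLimit.add_def]
    simp only [DirectLimit.lift_def]
    exact ColimHom.push_add ..)

lemma proPrecomp_mk {X Y : Tower C} (f : proHom X Y) (c : C) (n : ℕ+) (g : Y.obj (op n) ⟶ c) :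
    proPrecomp f c (ColimHom.mk n g) = ColimHom.push X g (f.1 n) := rfl

lemma push_proPrecomp {X Y : Tower C} (f : proHom X Y) {c d : C} (g : c ⟶ d)
    (y : ColimHom Y c) :
    ColimHom.push X g (proPrecomp f c y) = proPrecomp f d (ColimHom.push Y g y) := by
  induction y using ColimHom.ind with
  | h i h => simp only [ColimHom.push_mk, proPrecomp_mk, ColimHom.push_push]

/-- A map of inverse systems, viewed as a pro-map. -/
def levelHom {X Y : Tower C} (f : X ⟶ Y) : proHom X Y :=
  ⟨fun n => ColimHom.mk n (f.app (op n)), by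
    intro m n h
    rw [ColimHom.push_mk, ← f.naturality, ColimHom.mk_trans]⟩

/-- Composition of pro-maps. -/
def proComp {X Y Z : Tower C} (f : proHom X Y) (g : proHom Y Z) : proHom X Z :=
  ⟨fun n => proPrecomp f _ (g.1 n), by
    intro m n h
    rw [push_proPrecomp, g.2 m n h]⟩

lemma proPrecomp_proComp {X Y Z : Tower C} (f : proHom X Y) (g : proHom Y Z) (c : C)
    (z : ColimHom Z c) :
    proPrecomp (proComp f g) c z = proPrecomp f c (proPrecomp g c z) := by
  induction z using ColimHom.ind with
  | h i h =>
    rw [proPrecomp_mk, proPrecomp_mk, ← push_proPrecomp]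
    rfl

lemma proPrecomp_levelHom {X Y : Tower C} (f : X ⟶ Y) (c : C) (n : ℕ+) (g : Y.obj (op n) ⟶ c) :
    proPrecomp (levelHom f) c (ColimHom.mk n g) = ColimHom.mk n (f.app (op n) ≫ g) := rfl

lemma proPrecomp_add {X Y : Tower C} (f g : proHom X Y) (c : C) (y : ColimHom Y c) :
    proPrecomp (f + g) c y = proPrecomp f c y + proPrecomp g c y := by
  induction y using ColimHom.ind with
  | h i h =>
    simp only [proPrecomp_mk, ← map_add]
    rfl

lemma proPrecomp_id {X : Tower C} (c : C) (x : ColimHom X c) :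
    proPrecomp (levelHom (𝟙 X)) c x = x := by
  induction x using ColimHom.ind with
  | h i h =>
    rw [proPrecomp_levelHom]
    simp

lemma ColimHom.ind₂ {X Y : Tower C} {c d : C} {P : ColimHom X c → ColimHom Y d → Prop}
    (h : ∀ i f g, P (ColimHom.mk i f) (ColimHom.mk i g)) (x y) : P x y := by
  induction x using ColimHom.ind with
  | h i f =>
    induction y using ColimHom.ind with
    | h j g =>
      rw [← ColimHom.mk_trans (le_max_left i j) f, ← ColimHom.mk_trans (le_max_right i j) g]
      exact h _ _ _

lemma levelHom_comp {X Y Z : Tower C} (f : X ⟶ Y) (g : Y ⟶ Z) :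
    proComp (levelHom f) (levelHom g) = levelHom (f ≫ g) := rfl


end Pro

/-- A pro-object of `C`: an inverse system indexed by the positive integers, regarded as an
object of the pro-category. -/
structure ProObj (C : Type u) [Category.{v} C] where
  /-- the underlying inverse system -/
  tower : Tower C

section Pro

variable {C : Type u} [Category.{v} C] [Preadditive C]

/-- The pro-category: `hom(X, Y) = lim_n colim_m hom(X_m, Y_n)`. -/
instance : Category.{v} (ProObj C) where
  Hom X Y := proHom X.tower Y.tower
  id X := levelHom (𝟙 X.tower)
  comp f g := proComp f g
  id_comp f := Subtype.ext (funext fun _ => proPrecomp_id _ _)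
  comp_id {X Y} f := Subtype.ext (funext fun n => by
    change ColimHom.push _ ((𝟙 Y.tower : Y.tower ⟶ Y.tower).app (op n)) (f.1 n) = f.1 n
    rw [NatTrans.id_app, ColimHom.push_id])
  assoc f g h := Subtype.ext (funext fun _ => proPrecomp_proComp _ _ _ _)

instance : Preadditive (ProObj C) where
  homGroup X Y := inferInstanceAs (AddCommGroup (proHom X.tower Y.tower))
  add_comp _ _ _ _ _ _ := Subtype.ext (funext fun _ => proPrecomp_add _ _ _ _)
  comp_add _ _ _ f g g' :=
    Subtype.ext (funext fun n => map_add (proPrecomp f _) (g.1 n) (g'.1 n))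

/-- The functor from inverse systems to pro-objects; it is the identity on objects. -/
def toPro (C : Type u) [Category.{v} C] [Preadditive C] : Tower C ⥤ ProObj C where
  obj X := ⟨X⟩
  map f := levelHom f
  map_id _ := rfl
  map_comp _ _ := rfl

instance : (toPro C).Additive where
  map_add := Subtype.ext (funext fun _ => ColimHom.mk_add _ _ _)

/-- The embedding of `C` into the pro-category as the constant pro-objects. -/
def constPro (C : Type u) [Category.{v} C] [Preadditive C] : C ⥤ ProObj C :=
  Functor.const ℕ+ᵒᵖ ⋙ toPro C

/-- The basic objects of the pro-category: the (pro-objects isomorphic to) constant pro-objects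
on relatively injective objects of `C`. -/
def proBasic (J : ObjectProperty C) : ObjectProperty (ProObj C) :=
  (RelativelyInjective J).map (constPro C)

end Pro

section ProMonoidal

variable {C : Type u} [Category.{v} C] [Preadditive C] [MonoidalCategory C]

/-- The tensor product of maps `X_i ⟶ c` and `Y_i ⟶ d`. -/
def levelTensor {X Y : Tower C} {c d : C} {i : ℕ+} (f : X.obj (op i) ⟶ c)
    (g : Y.obj (op i) ⟶ d) : (X ⊗ Y).obj (op i) ⟶ c ⊗ d :=
  f ⊗ₘ g

lemma levelTensor_comp {X Y : Tower C} {c d c' d' : C} {i : ℕ+} (f : X.obj (op i) ⟶ c)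
    (g : Y.obj (op i) ⟶ d) (h : c ⟶ c') (k : d ⟶ d') :
    levelTensor f g ≫ (h ⊗ₘ k) = levelTensor (f ≫ h) (g ≫ k) :=
  tensorHom_comp_tensorHom f g h k

lemma map_levelTensor {X Y : Tower C} {c d : C} {i j : ℕ+} (h : op j ⟶ op i)
    (f : X.obj (op i) ⟶ c) (g : Y.obj (op i) ⟶ d) :
    (X ⊗ Y).map h ≫ levelTensor f g = levelTensor (X.map h ≫ f) (Y.map h ≫ g) :=
  tensorHom_comp_tensorHom _ _ _ _

/-- The map `colim_m hom(X_m, c) × colim_m hom(Y_m, d) → colim_m hom(X_m ⊗ Y_m, c ⊗ d)`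
sending the classes of `f` and `g` to the class of `f ⊗ g`. -/
def colimTensor {X Y : Tower C} {c d : C} :
    ColimHom X c → ColimHom Y d → ColimHom (X ⊗ Y) (c ⊗ d) :=
  DirectLimit.map₂ (homTrans X c) (homTrans Y d) (homTrans (X ⊗ Y) (c ⊗ d))
    (fun _ f g => levelTensor f g) (fun _ _ _ _ _ => map_levelTensor _ _ _)

lemma colimTensor_mk {X Y : Tower C} {c d : C} (i : ℕ+) (f : X.obj (op i) ⟶ c)
    (g : Y.obj (op i) ⟶ d) :
    colimTensor (ColimHom.mk i f) (ColimHom.mk i g) = ColimHom.mk i (levelTensor f g) :=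
  DirectLimit.map₂_def (F₁ := fun i : ℕ+ => (X.obj (op i) ⟶ c))
    (F₂ := fun i : ℕ+ => (Y.obj (op i) ⟶ d)) (F := fun i : ℕ+ => ((X ⊗ Y).obj (op i) ⟶ c ⊗ d))
    (homTrans X c) (homTrans Y d) (homTrans (X ⊗ Y) (c ⊗ d)) _ _ i f g

lemma push_colimTensor {X Y : Tower C} {c d c' d' : C} (g : c ⟶ c') (h : d ⟶ d')
    (x : ColimHom X c) (y : ColimHom Y d) :
    ColimHom.push (X ⊗ Y) (g ⊗ₘ h) (colimTensor x y) =
      colimTensor (ColimHom.push X g x) (ColimHom.push Y h y) := by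
  induction x, y using ColimHom.ind₂ with
  | h i a b =>
    rw [colimTensor_mk, ColimHom.push_mk, ColimHom.push_mk, ColimHom.push_mk, colimTensor_mk,
      levelTensor_comp]

lemma colimTensor_add {X Y : Tower C} {c d : C} [MonoidalPreadditive C] (x : ColimHom X c)
    (y y' : ColimHom Y d) : colimTensor x (y + y') = colimTensor x y + colimTensor x y' := by
  induction y, y' using ColimHom.ind₂ with
  | h i b b' =>
    induction x using ColimHom.ind with
    | h j a =>
      rw [← ColimHom.mk_add, ← ColimHom.mk_trans (le_max_left i j) b,
        ← ColimHom.mk_trans (le_max_left i j) b', ← ColimHom.mk_trans (le_max_left i j) (b + b'),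
        ← ColimHom.mk_trans (le_max_right i j) a, colimTensor_mk, colimTensor_mk, colimTensor_mk,
        ← ColimHom.mk_add, Preadditive.comp_add]
      exact congrArg _ (MonoidalPreadditive.tensor_add _ _ _)

lemma add_colimTensor {X Y : Tower C} {c d : C} [MonoidalPreadditive C] (x x' : ColimHom X c)
    (y : ColimHom Y d) : colimTensor (x + x') y = colimTensor x y + colimTensor x' y := by
  induction x, x' using ColimHom.ind₂ with
  | h i b b' =>
    induction y using ColimHom.ind with
    | h j a =>
      rw [← ColimHom.mk_add, ← ColimHom.mk_trans (le_max_left i j) b,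
        ← ColimHom.mk_trans (le_max_left i j) b', ← ColimHom.mk_trans (le_max_left i j) (b + b'),
        ← ColimHom.mk_trans (le_max_right i j) a, colimTensor_mk, colimTensor_mk, colimTensor_mk,
        ← ColimHom.mk_add, Preadditive.comp_add]
      exact congrArg _ (MonoidalPreadditive.add_tensor _ _ _)

/-- The tensor product of two pro-maps. -/
def proTensor {X X' Y Y' : Tower C} (f : proHom X X') (g : proHom Y Y') :
    proHom (X ⊗ Y) (X' ⊗ Y') :=
  ⟨fun n => colimTensor (f.1 n) (g.1 n), fun m n h => by
    refine (push_colimTensor _ _ (f.1 n) (g.1 n)).trans ?_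
    rw [f.2 m n h, g.2 m n h]⟩

lemma proTensor_levelHom {X X' Y Y' : Tower C} (f : X ⟶ X') (g : Y ⟶ Y') :
    proTensor (levelHom f) (levelHom g) = levelHom (f ⊗ₘ g) :=
  Subtype.ext (funext fun n => colimTensor_mk n (f.app (op n)) (g.app (op n)))

lemma proTensor_comp {X Y Z X' Y' Z' : Tower C} (f : proHom X Y) (f' : proHom X' Y')
    (g : proHom Y Z) (g' : proHom Y' Z') :
    proComp (proTensor f f') (proTensor g g') = proTensor (proComp f g) (proComp f' g') :=
  Subtype.ext (funext fun n => by
    change proPrecomp (proTensor f f') _ (colimTensor (g.1 n) (g'.1 n)) =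
      colimTensor (proPrecomp f _ (g.1 n)) (proPrecomp f' _ (g'.1 n))
    generalize g.1 n = a
    generalize g'.1 n = b
    induction a, b using ColimHom.ind₂ with
    | h i a b =>
      rw [colimTensor_mk, proPrecomp_mk, proPrecomp_mk, proPrecomp_mk]
      exact push_colimTensor _ _ _ _)

lemma proTensor_associator {X Y Z X' Y' Z' : Tower C} (f : proHom X X') (g : proHom Y Y')
    (h : proHom Z Z') :
    proComp (proTensor (proTensor f g) h) (levelHom (α_ X' Y' Z').hom) =
      proComp (levelHom (α_ X Y Z).hom) (proTensor f (proTensor g h)) :=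
  Subtype.ext (funext fun n => by
    change ColimHom.push _ (α_ _ _ _).hom (colimTensor (colimTensor (f.1 n) (g.1 n)) (h.1 n)) =
      proPrecomp (levelHom (α_ X Y Z).hom) _
        (colimTensor (f.1 n) (colimTensor (g.1 n) (h.1 n)))
    generalize f.1 n = a
    generalize g.1 n = b
    generalize h.1 n = c
    induction a using ColimHom.ind with
    | h i a =>
      induction b, c using ColimHom.ind₂ with
      | h j b c =>
        rw [← ColimHom.mk_trans (le_max_left i j) a, ← ColimHom.mk_trans (le_max_right i j) b,
          ← ColimHom.mk_trans (le_max_right i j) c, colimTensor_mk, colimTensor_mk,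
          colimTensor_mk, colimTensor_mk, ColimHom.push_mk, proPrecomp_levelHom]
        exact congrArg _ (MonoidalCategory.associator_naturality _ _ _))

lemma proTensor_leftUnitor {X Y : Tower C} (f : proHom X Y) :
    proComp (proTensor (levelHom (𝟙 (𝟙_ (Tower C)))) f) (levelHom (λ_ Y).hom) =
      proComp (levelHom (λ_ X).hom) f :=
  Subtype.ext (funext fun n => by
    change ColimHom.push _ (λ_ _).hom
      (colimTensor (ColimHom.mk (X := 𝟙_ (Tower C)) n (𝟙 (𝟙_ C))) (f.1 n)) =
        proPrecomp (levelHom (λ_ X).hom) _ (f.1 n)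
    generalize f.1 n = a
    induction a using ColimHom.ind with
    | h i a =>
      rw [← ColimHom.mk_trans (le_max_left i n) a,
        ← ColimHom.mk_trans (X := 𝟙_ (Tower C)) (le_max_right i n), colimTensor_mk,
        ColimHom.push_mk, proPrecomp_levelHom]
      refine congrArg _ (Eq.trans ?_ (MonoidalCategory.leftUnitor_naturality _))
      change ((𝟙 _ ≫ 𝟙 _) ⊗ₘ _) ≫ _ = _
      rw [Category.comp_id, id_tensorHom]
      rfl)

lemma proTensor_rightUnitor {X Y : Tower C} (f : proHom X Y) :
    proComp (proTensor f (levelHom (𝟙 (𝟙_ (Tower C))))) (levelHom (ρ_ Y).hom) =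
      proComp (levelHom (ρ_ X).hom) f :=
  Subtype.ext (funext fun n => by
    change ColimHom.push _ (ρ_ _).hom
      (colimTensor (f.1 n) (ColimHom.mk (X := 𝟙_ (Tower C)) n (𝟙 (𝟙_ C)))) =
        proPrecomp (levelHom (ρ_ X).hom) _ (f.1 n)
    generalize f.1 n = a
    induction a using ColimHom.ind with
    | h i a =>
      rw [← ColimHom.mk_trans (le_max_left i n) a,
        ← ColimHom.mk_trans (X := 𝟙_ (Tower C)) (le_max_right i n), colimTensor_mk,
        ColimHom.push_mk, proPrecomp_levelHom]
      refine congrArg _ (Eq.trans ?_ (MonoidalCategory.rightUnitor_naturality _))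
      change (_ ⊗ₘ (𝟙 _ ≫ 𝟙 _)) ≫ _ = _
      rw [Category.comp_id, tensorHom_id]
      rfl)

/-- The tensor product of pro-objects is computed levelwise: `(X ⊗ Y)_n = X_n ⊗ Y_n`. -/
instance : MonoidalCategoryStruct (ProObj C) where
  tensorObj X Y := ⟨X.tower ⊗ Y.tower⟩
  tensorHom f g := proTensor f g
  whiskerLeft X _ _ f := proTensor (levelHom (𝟙 X.tower)) f
  whiskerRight f Y := proTensor f (levelHom (𝟙 Y.tower))
  tensorUnit := ⟨𝟙_ (Tower C)⟩
  associator X Y Z := (toPro C).mapIso (α_ X.tower Y.tower Z.tower)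
  leftUnitor X := (toPro C).mapIso (λ_ X.tower)
  rightUnitor X := (toPro C).mapIso (ρ_ X.tower)

instance : MonoidalCategory (ProObj C) :=
  MonoidalCategory.ofTensorHom
    (id_tensorHom_id := fun X Y => (proTensor_levelHom (𝟙 X.tower) (𝟙 Y.tower)).trans
      (congrArg levelHom (id_tensorHom_id X.tower Y.tower)))
    (id_tensorHom := fun _ _ _ _ => rfl)
    (tensorHom_id := fun _ _ => rfl)
    (tensorHom_comp_tensorHom := fun f f' g g' => proTensor_comp f f' g g')
    (associator_naturality := fun f g h => proTensor_associator f g h)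
    (leftUnitor_naturality := fun f => proTensor_leftUnitor f)
    (rightUnitor_naturality := fun f => proTensor_rightUnitor f)
    (pentagon := fun W X Y Z => by
      change proComp (proTensor (levelHom (α_ W.tower X.tower Y.tower).hom)
          (levelHom (𝟙 Z.tower))) (proComp (levelHom (α_ W.tower (X.tower ⊗ Y.tower) Z.tower).hom)
          (proTensor (levelHom (𝟙 W.tower)) (levelHom (α_ X.tower Y.tower Z.tower).hom))) =
        proComp (levelHom (α_ (W.tower ⊗ X.tower) Y.tower Z.tower).hom)
          (levelHom (α_ W.tower X.tower (Y.tower ⊗ Z.tower)).hom)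
      rw [proTensor_levelHom, proTensor_levelHom, levelHom_comp, levelHom_comp, levelHom_comp,
        tensorHom_id, id_tensorHom, MonoidalCategory.pentagon])
    (triangle := fun X Y => by
      change proComp (levelHom (α_ X.tower (𝟙_ _) Y.tower).hom)
          (proTensor (levelHom (𝟙 X.tower)) (levelHom (λ_ Y.tower).hom)) =
        proTensor (levelHom (ρ_ X.tower).hom) (levelHom (𝟙 Y.tower))
      rw [proTensor_levelHom, proTensor_levelHom, levelHom_comp,
        tensorHom_id, id_tensorHom, MonoidalCategory.triangle])

lemma proTensor_add [MonoidalPreadditive C] {X X' Y Y' : Tower C} (f : proHom X X')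
    (g g' : proHom Y Y') : proTensor f (g + g') = proTensor f g + proTensor f g' :=
  Subtype.ext (funext fun n => colimTensor_add (f.1 n) (g.1 n) (g'.1 n))

lemma add_proTensor [MonoidalPreadditive C] {X X' Y Y' : Tower C} (f f' : proHom X X')
    (g : proHom Y Y') : proTensor (f + f') g = proTensor f g + proTensor f' g :=
  Subtype.ext (funext fun n => add_colimTensor (f.1 n) (f'.1 n) (g.1 n))

lemma proTensor_zero [MonoidalPreadditive C] {X X' Y Y' : Tower C} (f : proHom X X') :
    proTensor f (0 : proHom Y Y') = 0 :=
  left_eq_add.1 (by rw [← proTensor_add f (0 : proHom Y Y') 0, add_zero])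

lemma zero_proTensor [MonoidalPreadditive C] {X X' Y Y' : Tower C} (g : proHom Y Y') :
    proTensor (0 : proHom X X') g = 0 :=
  left_eq_add.1 (by rw [← add_proTensor (0 : proHom X X') 0 g, add_zero])

instance [MonoidalPreadditive C] : MonoidalPreadditive (ProObj C) where
  whiskerLeft_zero := proTensor_zero _
  zero_whiskerRight := zero_proTensor _
  whiskerLeft_add f g := proTensor_add _ f g
  add_whiskerRight f g := add_proTensor f g _

instance [HasBinaryBiproducts C] : HasBinaryBiproducts (ProObj C) where
  has_binary_biproduct X Y := by
    have : HasBinaryBiproducts (Tower C) := HasBinaryBiproducts.of_hasBinaryProducts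
    have : PreservesBinaryBiproducts (toPro C) :=
      preservesBinaryBiproducts_of_preservesBiproducts (toPro C)
    exact Functor.hasBinaryBiproduct_of_preserves (toPro C) X.tower Y.tower

end ProMonoidal

section Algebras

variable {C : Type u} [Category.{v} C] [MonoidalCategory C]

/-- An algebra in a monoidal category: a not necessarily unital monoid. -/
structure Alg (C : Type u) [Category.{v} C] [MonoidalCategory C] where
  /-- the underlying object -/
  X : C
  /-- the multiplication -/
  mul : X ⊗ X ⟶ X
  assoc : mul ▷ X ≫ mul = (α_ X X X).hom ≫ X ◁ mul ≫ mul

/-- A homomorphism of algebras. -/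
@[ext]
structure Alg.Hom (R S : Alg C) where
  /-- the underlying map -/
  hom : R.X ⟶ S.X
  map_mul : R.mul ≫ hom = (hom ⊗ₘ hom) ≫ S.mul

instance : Category.{v} (Alg C) where
  Hom R S := Alg.Hom R S
  id R := ⟨𝟙 R.X, by simp⟩
  comp f g := ⟨f.hom ≫ g.hom, by
    rw [← Category.assoc, f.map_mul, Category.assoc, g.map_mul,
      tensorHom_comp_tensorHom_assoc]⟩

@[ext]
lemma Alg.hom_ext {R S : Alg C} {f g : R ⟶ S} (h : f.hom = g.hom) : f = g := Alg.Hom.ext h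

@[simp] lemma Alg.id_hom (R : Alg C) : Alg.Hom.hom (𝟙 R) = 𝟙 R.X := rfl

@[simp] lemma Alg.comp_hom {R S T : Alg C} (f : R ⟶ S) (g : S ⟶ T) :
    (f ≫ g).hom = f.hom ≫ g.hom := rfl

/-- The underlying object of an algebra. -/
def Alg.forget (C : Type u) [Category.{v} C] [MonoidalCategory C] : Alg C ⥤ C where
  obj R := R.X
  map f := f.hom

/-- A homomorphism `i : K ⟶ A` exhibits `K` as a (two-sided) ideal of `A` if it is a monomorphism
and both multiplications `A ⊗ K ⟶ A` and `K ⊗ A ⟶ A` factor through `i`. -/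
structure IsIdeal {K A : Alg C} (i : K ⟶ A) : Prop where
  mono : Mono i.hom
  left : ∃ l : A.X ⊗ K.X ⟶ K.X, l ≫ i.hom = A.X ◁ i.hom ≫ A.mul
  right : ∃ r : K.X ⊗ A.X ⟶ K.X, r ≫ i.hom = i.hom ▷ A.X ≫ A.mul

namespace Alg

variable (R : Alg C)

/-- The tensor power `R ⊗ (R ⊗ (⋯ ⊗ R))` with `n + 1` factors. -/
def pow : ℕ → C
  | 0 => R.X
  | n + 1 => R.X ⊗ pow n

lemma assoc_inv : (α_ R.X R.X R.X).inv ≫ R.mul ▷ R.X ≫ R.mul = R.X ◁ R.mul ≫ R.mul := by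
  rw [R.assoc, Iso.inv_hom_id_assoc]

/-- Left multiplication on `R ⊗ X`: `a ⊗ (b ⊗ x) ↦ ab ⊗ x`. -/
def freeAct (X : C) : R.X ⊗ (R.X ⊗ X) ⟶ R.X ⊗ X :=
  (α_ R.X R.X X).inv ≫ R.mul ▷ X

lemma freeAct_natural {X Y : C} (f : X ⟶ Y) :
    R.freeAct X ≫ R.X ◁ f = R.X ◁ (R.X ◁ f) ≫ R.freeAct Y := by
  simp only [freeAct, Category.assoc]
  rw [← whisker_exchange]
  simp

lemma freeAct_freeAct (X : C) :
    R.X ◁ R.freeAct X ≫ R.freeAct X =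
      (α_ R.X R.X (R.X ⊗ X)).inv ≫ R.mul ▷ (R.X ⊗ X) ≫ R.freeAct X := by
  have h := congrArg (fun f => R.X ◁ (α_ R.X R.X X).inv ≫ (α_ R.X (R.X ⊗ R.X) X).inv ≫ f ▷ X)
    R.assoc_inv
  simp only [comp_whiskerRight, freeAct, MonoidalCategory.whiskerLeft_comp, Category.assoc]
    at h ⊢
  simpa using h.symm

lemma freeAct_mul : R.freeAct R.X ≫ R.mul = R.X ◁ R.mul ≫ R.mul := by
  rw [freeAct, Category.assoc, R.assoc_inv]

/-- Multiplication into the first factor, `a ⊗ (a₀ ⊗ ⋯ ⊗ aₙ) ↦ a a₀ ⊗ a₁ ⊗ ⋯ ⊗ aₙ`. -/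
def act : ∀ n : ℕ, R.X ⊗ R.pow n ⟶ R.pow n
  | 0 => R.mul
  | n + 1 => R.freeAct (R.pow n)

lemma act_act (n : ℕ) :
    R.X ◁ R.act n ≫ R.act n = (α_ R.X R.X (R.pow n)).inv ≫ R.mul ▷ R.pow n ≫ R.act n := by
  cases n with
  | zero => exact R.assoc_inv.symm
  | succ n => exact R.freeAct_freeAct (R.pow n)

/-- The multiplication map `R^{⊗ (n + 1)} ⟶ R`, `a₀ ⊗ ⋯ ⊗ aₙ ↦ a₀ ⋯ aₙ`. -/
def mulPow : ∀ n : ℕ, R.pow n ⟶ R.X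
  | 0 => 𝟙 R.X
  | n + 1 => R.X ◁ mulPow n ≫ R.mul

lemma act_mulPow (n : ℕ) : R.act n ≫ R.mulPow n = R.X ◁ R.mulPow n ≫ R.mul := by
  cases n with
  | zero =>
    change R.mul ≫ 𝟙 R.X = R.X ◁ 𝟙 R.X ≫ R.mul
    simp
  | succ n =>
    change R.freeAct (R.pow n) ≫ R.X ◁ R.mulPow n ≫ R.mul =
      R.X ◁ (R.X ◁ R.mulPow n ≫ R.mul) ≫ R.mul
    rw [← Category.assoc, freeAct_natural, Category.assoc, freeAct_mul]
    simp

section Preadditive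

variable [Preadditive C]

/-- The boundary `b' : R^{⊗ (n + 2)} ⟶ R^{⊗ (n + 1)}` of the bar complex,
`b'(a₀ ⊗ ⋯ ⊗ aₙ₊₁) = ∑ (-1)ⁱ a₀ ⊗ ⋯ ⊗ aᵢ aᵢ₊₁ ⊗ ⋯ ⊗ aₙ₊₁`, written recursively as
`b'(a ⊗ b ⊗ x) = ab ⊗ x - a ⊗ b'(b ⊗ x)`. -/
def barD : ∀ n : ℕ, R.X ⊗ R.pow n ⟶ R.pow n
  | 0 => R.mul
  | n + 1 => (R.freeAct (R.pow n) - R.X ◁ barD n : R.X ⊗ (R.X ⊗ R.pow n) ⟶ R.X ⊗ R.pow n)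

lemma freeAct_barD [MonoidalPreadditive C] (n : ℕ) :
    R.freeAct (R.pow n) ≫ R.barD n = R.X ◁ R.barD n ≫ R.act n := by
  cases n with
  | zero => exact R.freeAct_mul
  | succ n =>
    change R.freeAct (R.X ⊗ R.pow n) ≫ (R.freeAct (R.pow n) - R.X ◁ R.barD n) =
      R.X ◁ (R.freeAct (R.pow n) - R.X ◁ R.barD n) ≫ R.freeAct (R.pow n)
    have h : R.X ◁ (R.freeAct (R.pow n) - R.X ◁ R.barD n) =
        R.X ◁ R.freeAct (R.pow n) - R.X ◁ (R.X ◁ R.barD n) := (tensorLeft R.X).map_sub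
    rw [Preadditive.comp_sub, h, Preadditive.sub_comp,
      freeAct_freeAct, freeAct_natural]
    simp only [freeAct, Category.assoc]

lemma barD_barD [MonoidalPreadditive C] (n : ℕ) :
    (R.barD (n + 1) : R.X ⊗ (R.X ⊗ R.pow n) ⟶ R.X ⊗ R.pow n) ≫ R.barD n = 0 := by
  induction n with
  | zero =>
    change (R.freeAct R.X - R.X ◁ R.mul) ≫ R.mul = 0
    rw [Preadditive.sub_comp, freeAct_mul, sub_self]
  | succ n ih =>
    have h : (R.freeAct (R.pow (n + 1)) - R.X ◁ R.barD (n + 1)) ≫ R.barD (n + 1) =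
        R.X ◁ R.barD (n + 1) ≫ (R.act (n + 1) - R.barD (n + 1)) := by
      rw [Preadditive.sub_comp, freeAct_barD, Preadditive.comp_sub]
    refine h.trans ?_
    change R.X ◁ R.barD (n + 1) ≫
      (R.freeAct (R.pow n) - (R.freeAct (R.pow n) - R.X ◁ R.barD n)) = 0
    rw [sub_sub_cancel]
    exact (MonoidalCategory.whiskerLeft_comp _ _ _).symm.trans
      ((congrArg (fun f => R.X ◁ f) ih).trans MonoidalPreadditive.whiskerLeft_zero)

/-- The bar complex `C^bar(R)`, with `R^{⊗ (n + 1)}` in degree `n` and boundary `b'`. -/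
def bar [MonoidalPreadditive C] : ChainComplex C ℕ :=
  ChainComplex.of R.pow R.barD R.barD_barD

/-- `R` is `H`-unital if `V ⊗ C^bar(R)` is weakly contractible for every object `V`. -/
def IsHUnital [MonoidalPreadditive C] (J : ObjectProperty C) : Prop :=
  ∀ V : C, IsWeaklyContractible J (((tensorLeft V).mapHomologicalComplex _).obj R.bar)

variable [HasBinaryBiproducts C]

/-- The underlying object `R ⊕ k` of the unitalization of `R`. -/
def unitization : C := R.X ⊞ 𝟙_ C

/-- Left multiplication `R ⊗ (R ⊕ k) ⟶ R ⊕ k`, `a ⊗ (b + s) ↦ ab + as`. -/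
def mulUnitization : R.X ⊗ R.unitization ⟶ R.unitization :=
  (R.X ◁ biprod.fst ≫ R.mul + R.X ◁ biprod.snd ≫ (ρ_ R.X).hom) ≫ biprod.inl

/-- Right multiplication `(R ⊕ k) ⊗ R ⟶ R ⊕ k`, `(b + s) ⊗ a ↦ ba + sa`. -/
def unitizationMul : R.unitization ⊗ R.X ⟶ R.unitization :=
  (biprod.fst ▷ R.X ≫ R.mul + biprod.snd ▷ R.X ≫ (λ_ R.X).hom) ≫ biprod.inl

/-- The bimodule `Ω² R = (R ⊕ k) ⊗ R ⊗ R` of noncommutative two-forms; `r ⊗ a₁ ⊗ a₂` stands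
for `r da₁ da₂`. -/
def Omega2 : C := R.unitization ⊗ (R.X ⊗ R.X)

/-- The left action `a ⊗ r da₁ da₂ ↦ ar da₁ da₂`. -/
def omegaLeft : R.X ⊗ R.Omega2 ⟶ R.Omega2 :=
  (α_ R.X R.unitization (R.X ⊗ R.X)).inv ≫ R.mulUnitization ▷ (R.X ⊗ R.X)

/-- The right action
`r da₁ da₂ ⊗ b ↦ r da₁ d(a₂ b) - r d(a₁ a₂) db + r a₁ da₂ db`. -/
def omegaRight : R.Omega2 ⊗ R.X ⟶ R.Omega2 :=
  (α_ R.unitization (R.X ⊗ R.X) R.X).hom ≫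
    (R.unitization ◁ ((α_ R.X R.X R.X).hom ≫ R.X ◁ R.mul)
      - R.unitization ◁ (R.mul ▷ R.X)
      + R.unitization ◁ (α_ R.X R.X R.X).hom ≫
          (α_ R.unitization R.X (R.X ⊗ R.X)).inv ≫ R.unitizationMul ▷ (R.X ⊗ R.X))

/-- The Hochschild `2`-cochain `d ∪ d : R ⊗ R ⟶ Ω² R`, `a ⊗ b ↦ da db`. -/
def dCupD : R.X ⊗ R.X ⟶ R.Omega2 :=
  (λ_ (R.X ⊗ R.X)).inv ≫ biprod.inr ▷ (R.X ⊗ R.X)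

/-- The Hochschild coboundary of a `1`-cochain `φ : R ⟶ Ω² R`:
`(δφ)(a, b) = a φ(b) - φ(ab) + φ(a) b`. -/
def coboundary (φ : R.X ⟶ R.Omega2) : R.X ⊗ R.X ⟶ R.Omega2 :=
  R.X ◁ φ ≫ R.omegaLeft - R.mul ≫ φ + φ ▷ R.X ≫ R.omegaRight

/-- `R` is quasi-free if `d ∪ d` is a coboundary. -/
def IsQuasiFree : Prop := ∃ φ : R.X ⟶ R.Omega2, R.coboundary φ = R.dCupD

end Preadditive
end Alg

end Algebras

section Powers

variable {C : Type u} [Category.{v} C] [MonoidalCategory C]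

namespace Alg

/-- The map of tensor powers induced by a homomorphism of algebras. -/
def powHom {R S : Alg C} (f : R ⟶ S) : ∀ n : ℕ, R.pow n ⟶ S.pow n
  | 0 => f.hom
  | n + 1 => f.hom ⊗ₘ powHom f n

lemma powHom_mulPow {R S : Alg C} (f : R ⟶ S) (n : ℕ) :
    powHom f n ≫ S.mulPow n = R.mulPow n ≫ f.hom := by
  induction n with
  | zero => exact (Category.comp_id _).trans (Category.id_comp _).symm
  | succ n ih =>
    change (f.hom ⊗ₘ powHom f n) ≫ S.X ◁ S.mulPow n ≫ S.mul =
      (R.X ◁ R.mulPow n ≫ R.mul) ≫ f.hom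
    rw [Category.assoc, f.map_mul, ← Category.assoc, ← Category.assoc, ← id_tensorHom,
      ← id_tensorHom, tensorHom_comp_tensorHom, tensorHom_comp_tensorHom, ih, Category.comp_id,
      Category.id_comp]

variable [Preadditive C]

/-- The map `R^{⊗ (m + 1)} ⟶ R^{⊗ (n + 1)}`, for `n ≤ m`, which multiplies together the last
`m - n + 1` factors. (It is only used for `n ≤ m`, and it is set to `0` for `m < n`.) -/
def shrink (R : Alg C) : ∀ m n : ℕ, R.pow m ⟶ R.pow n
  | m, 0 => R.mulPow m
  | 0, _ + 1 => 0
  | m + 1, n + 1 => R.X ◁ shrink R m n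

lemma shrink_mulPow (R : Alg C) (m n : ℕ) (h : n ≤ m) :
    R.shrink m n ≫ R.mulPow n = R.mulPow m := by
  induction n generalizing m with
  | zero =>
    have : R.shrink m 0 = R.mulPow m := by cases m <;> rfl
    rw [this]
    exact Category.comp_id _
  | succ n ih =>
    cases m with
    | zero => omega
    | succ m =>
      change R.X ◁ R.shrink m n ≫ R.X ◁ R.mulPow n ≫ R.mul = R.X ◁ R.mulPow m ≫ R.mul
      rw [← ih m (by omega), MonoidalCategory.whiskerLeft_comp, Category.assoc]

variable [HasKernels C] [HasCokernels C]

/-- The underlying object of the power `R^{n + 1}`: the image (i.e. the cokernel of the kernel)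
of the multiplication map `R^{⊗ (n + 1)} ⟶ R`. -/
def powerObj (R : Alg C) (n : ℕ) : C := Abelian.coimage (R.mulPow n)

/-- The projection `R^{⊗ (n + 1)} ⟶ R^{n + 1}`. -/
def powerπ (R : Alg C) (n : ℕ) : R.pow n ⟶ R.powerObj n := Abelian.coimage.π (R.mulPow n)

/-- The canonical map `R^{n + 1} ⟶ R`. -/
def powerι (R : Alg C) (n : ℕ) : R.powerObj n ⟶ R.X := Abelian.factorThruCoimage (R.mulPow n)

instance (R : Alg C) (n : ℕ) : Epi (R.powerπ n) :=
  inferInstanceAs (Epi (cokernel.π _))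

lemma powerπ_ι (R : Alg C) (n : ℕ) : R.powerπ n ≫ R.powerι n = R.mulPow n :=
  Abelian.coimage.fac _

lemma comp_powerπ_eq (R : Alg C) {n : ℕ} {Z : C} {f g : Z ⟶ R.pow n}
    (h : f ≫ R.mulPow n = g ≫ R.mulPow n) : f ≫ R.powerπ n = g ≫ R.powerπ n := by
  rw [← sub_eq_zero, ← Preadditive.sub_comp] at h ⊢
  exact (congrArg (fun k => k ≫ R.powerπ n) (kernel.lift_ι _ _ h).symm).trans
    ((Category.assoc _ _ _).trans
      ((congrArg _ (cokernel.condition (kernel.ι (R.mulPow n)))).trans comp_zero))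

/-- A map out of `R^{n + 1}` is a map out of `R^{⊗ (n + 1)}` which kills the kernel of the
multiplication. -/
def powerDesc (R : Alg C) {n : ℕ} {Z : C} (f : R.pow n ⟶ Z)
    (h : kernel.ι (R.mulPow n) ≫ f = 0) : R.powerObj n ⟶ Z :=
  cokernel.desc _ f h

lemma powerπ_desc (R : Alg C) {n : ℕ} {Z : C} (f : R.pow n ⟶ Z)
    (h : kernel.ι (R.mulPow n) ≫ f = 0) : R.powerπ n ≫ R.powerDesc f h = f :=
  cokernel.π_desc _ _ _

variable [MonoidalPreadditive C]
  [∀ (X : C) ⦃Y Z : C⦄ (f : Y ⟶ Z), PreservesColimit (parallelPair f 0) (tensorLeft X)]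

lemma epi_whiskerLeft_cokernelπ {Y Z : C} (f : Y ⟶ Z) (X : C) : Epi (X ◁ cokernel.π f) := by
  have h : Epi ((tensorLeft X).map (cokernel.π f)) := by
    rw [Iso.eq_comp_inv _ |>.2 (PreservesCokernel.π_iso_hom (tensorLeft X) f)]
    infer_instance
  exact h

lemma epi_whiskerLeft_powerπ (R : Alg C) (n : ℕ) (X : C) : Epi (X ◁ R.powerπ n) :=
  epi_whiskerLeft_cokernelπ _ X

lemma powerAct_aux (R : Alg C) (n : ℕ) :
    R.X ◁ kernel.ι (R.mulPow n) ≫ R.act n ≫ R.powerπ n = 0 := by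
  have h : (R.X ◁ kernel.ι (R.mulPow n) ≫ R.act n) ≫ R.mulPow n =
      (0 : R.X ⊗ kernel (R.mulPow n) ⟶ R.pow n) ≫ R.mulPow n := by
    rw [Category.assoc, act_mulPow, ← MonoidalCategory.whiskerLeft_comp_assoc, kernel.condition]
    simp
  rw [← Category.assoc, R.comp_powerπ_eq h, zero_comp]

/-- The left action `R ⊗ R^{n + 1} ⟶ R^{n + 1}` induced by multiplication into the first
factor of `R^{⊗ (n + 1)}`; it exists since `R ⊗ -` preserves cokernels. -/
def powerAct (R : Alg C) (n : ℕ) : R.X ⊗ R.powerObj n ⟶ R.powerObj n :=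
  (PreservesCokernel.iso (tensorLeft R.X) (kernel.ι (R.mulPow n))).hom ≫
    cokernel.desc ((tensorLeft R.X).map (kernel.ι (R.mulPow n))) (R.act n ≫ R.powerπ n)
      (R.powerAct_aux n)

lemma whiskerLeft_powerπ_act (R : Alg C) (n : ℕ) :
    R.X ◁ R.powerπ n ≫ R.powerAct n = R.act n ≫ R.powerπ n := by
  refine (PreservesCokernel.π_iso_hom_assoc (tensorLeft R.X) (kernel.ι (R.mulPow n)) _).trans ?_
  exact cokernel.π_desc _ _ _

lemma powerAct_ι (R : Alg C) (n : ℕ) :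
    R.powerAct n ≫ R.powerι n = R.X ◁ R.powerι n ≫ R.mul := by
  have := R.epi_whiskerLeft_powerπ n R.X
  rw [← cancel_epi (R.X ◁ R.powerπ n), ← Category.assoc, whiskerLeft_powerπ_act, Category.assoc,
    powerπ_ι, act_mulPow, ← MonoidalCategory.whiskerLeft_comp_assoc, powerπ_ι]

lemma powerAct_powerAct (R : Alg C) (n : ℕ) :
    R.X ◁ R.powerAct n ≫ R.powerAct n =
      (α_ R.X R.X (R.powerObj n)).inv ≫ R.mul ▷ R.powerObj n ≫ R.powerAct n := by
  have := R.epi_whiskerLeft_powerπ n (R.X ⊗ R.X)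
  have : Epi (R.X ◁ (R.X ◁ R.powerπ n)) := by
    have e : R.X ◁ (R.X ◁ R.powerπ n) = (α_ R.X R.X (R.pow n)).inv ≫
        (R.X ⊗ R.X) ◁ R.powerπ n ≫ (α_ R.X R.X (R.powerObj n)).hom := by simp
    rw [e]
    infer_instance
  rw [← cancel_epi (R.X ◁ (R.X ◁ R.powerπ n)), ← MonoidalCategory.whiskerLeft_comp_assoc,
    whiskerLeft_powerπ_act, MonoidalCategory.whiskerLeft_comp_assoc, whiskerLeft_powerπ_act,
    ← Category.assoc, act_act]
  simp only [Category.assoc]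
  rw [← whiskerLeft_powerπ_act, ← whisker_exchange_assoc]
  simp

/-- The power `R^{n + 1}` of an algebra `R`, as an algebra: the product of `x` and `y` is the
product in `R` of the image of `x` with `y`, i.e. it is induced by concatenation. -/
def power (R : Alg C) (n : ℕ) : Alg C where
  X := R.powerObj n
  mul := R.powerι n ▷ R.powerObj n ≫ R.powerAct n
  assoc := by
    have h : (R.powerι n ▷ R.powerObj n ≫ R.powerAct n) ≫ R.powerι n =
        (R.powerι n ⊗ₘ R.powerι n) ≫ R.mul := by
      rw [Category.assoc, powerAct_ι, MonoidalCategory.tensorHom_def, Category.assoc]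
    rw [← comp_whiskerRight_assoc, h, MonoidalCategory.whiskerLeft_comp, Category.assoc,
      whisker_exchange_assoc, powerAct_powerAct, MonoidalCategory.tensorHom_def']
    simp

/-- The canonical homomorphism `R^{n + 1} ⟶ R`. -/
def powerIncl (R : Alg C) (n : ℕ) : R.power n ⟶ R where
  hom := R.powerι n
  map_mul := by
    change (R.powerι n ▷ R.powerObj n ≫ R.powerAct n) ≫ R.powerι n = _
    rw [Category.assoc, powerAct_ι, ← Category.assoc]
    exact congrArg (fun k => k ≫ R.mul) (MonoidalCategory.tensorHom_def _ _).symm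

lemma powerMap_aux {R S : Alg C} (f : R ⟶ S) {m n : ℕ} (h : n ≤ m) :
    (R.shrink m n ≫ powHom f n) ≫ S.mulPow n = R.mulPow m ≫ f.hom := by
  rw [Category.assoc, powHom_mulPow, ← Category.assoc, shrink_mulPow _ _ _ h]

/-- For `n ≤ m`, the map `R^{m + 1} ⟶ S^{n + 1}` induced by a homomorphism `f : R ⟶ S`, on
underlying objects. -/
def powerMapHom {R S : Alg C} (f : R ⟶ S) {m n : ℕ} (h : n ≤ m) :
    R.powerObj m ⟶ S.powerObj n :=
  R.powerDesc ((R.shrink m n ≫ powHom f n) ≫ S.powerπ n) (by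
    rw [← Category.assoc, S.comp_powerπ_eq (g := 0), zero_comp]
    rw [Category.assoc, powerMap_aux f h, kernel.condition_assoc, zero_comp, zero_comp])

lemma powerπ_mapHom {R S : Alg C} (f : R ⟶ S) {m n : ℕ} (h : n ≤ m) (g : R.pow m ⟶ S.pow n)
    (hg : g ≫ S.mulPow n = R.mulPow m ≫ f.hom) :
    R.powerπ m ≫ powerMapHom f h = g ≫ S.powerπ n := by
  rw [powerMapHom, powerπ_desc]
  exact S.comp_powerπ_eq ((powerMap_aux f h).trans hg.symm)

lemma powerMapHom_ι {R S : Alg C} (f : R ⟶ S) {m n : ℕ} (h : n ≤ m) :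
    powerMapHom f h ≫ S.powerι n = R.powerι m ≫ f.hom := by
  rw [← cancel_epi (R.powerπ m), ← Category.assoc, powerπ_mapHom f h _ (powerMap_aux f h),
    Category.assoc, powerπ_ι, powerMap_aux f h, ← Category.assoc, powerπ_ι]

lemma powerAct_mapHom {R S : Alg C} (f : R ⟶ S) {m n : ℕ} (h : n ≤ m) :
    R.powerAct m ≫ powerMapHom f h = (f.hom ⊗ₘ powerMapHom f h) ≫ S.powerAct n := by
  have := R.epi_whiskerLeft_powerπ m R.X
  rw [← cancel_epi (R.X ◁ R.powerπ m), ← Category.assoc, whiskerLeft_powerπ_act, Category.assoc,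
    powerπ_mapHom f h _ (powerMap_aux f h), ← Category.assoc (R.X ◁ R.powerπ m), ← id_tensorHom,
    tensorHom_comp_tensorHom, Category.id_comp, powerπ_mapHom f h _ (powerMap_aux f h)]
  generalize hg : R.shrink m n ≫ powHom f n = g
  have hg' := powerMap_aux f h
  rw [hg] at hg'
  have e : (f.hom ⊗ₘ g ≫ S.powerπ n) = (f.hom ⊗ₘ g) ≫ S.X ◁ S.powerπ n := by
    rw [← id_tensorHom, tensorHom_comp_tensorHom, Category.comp_id]
  rw [e, Category.assoc, whiskerLeft_powerπ_act, ← Category.assoc, ← Category.assoc]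
  apply S.comp_powerπ_eq
  rw [Category.assoc, hg', Category.assoc, act_mulPow, ← Category.assoc, act_mulPow,
    Category.assoc, f.map_mul, ← id_tensorHom, ← id_tensorHom, tensorHom_comp_tensorHom_assoc,
    tensorHom_comp_tensorHom_assoc, hg', Category.comp_id, Category.id_comp]

/-- For `n ≤ m`, the homomorphism `R^{m + 1} ⟶ S^{n + 1}` induced by `f : R ⟶ S`. -/
def powerMap {R S : Alg C} (f : R ⟶ S) {m n : ℕ} (h : n ≤ m) : R.power m ⟶ S.power n where
  hom := powerMapHom f h
  map_mul := by
    change (R.powerι m ▷ R.powerObj m ≫ R.powerAct m) ≫ powerMapHom f h =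
      (powerMapHom f h ⊗ₘ powerMapHom f h) ≫ S.powerι n ▷ S.powerObj n ≫ S.powerAct n
    rw [Category.assoc, powerAct_mapHom, ← tensorHom_id, ← tensorHom_id,
      tensorHom_comp_tensorHom_assoc, tensorHom_comp_tensorHom_assoc, powerMapHom_ι,
      Category.id_comp, Category.comp_id]

lemma powerMap_id (R : Alg C) (n : ℕ) (h : n ≤ n) : powerMap (𝟙 R) h = 𝟙 (R.power n) := by
  apply hom_ext
  change powerMapHom (𝟙 R) h = 𝟙 (R.powerObj n)
  rw [← cancel_epi (R.powerπ n), powerπ_mapHom (𝟙 R) h (𝟙 _) (by simp)]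
  simp

lemma powerMap_comp {R S T : Alg C} (f : R ⟶ S) (g : S ⟶ T) {m n p : ℕ} (h : n ≤ m)
    (k : p ≤ n) (l : p ≤ m) : powerMap (f ≫ g) l = powerMap f h ≫ powerMap g k := by
  apply hom_ext
  change powerMapHom (f ≫ g) l = powerMapHom f h ≫ powerMapHom g k
  rw [← cancel_epi (R.powerπ m), ← Category.assoc, powerπ_mapHom f h _ (powerMap_aux f h),
    Category.assoc, powerπ_mapHom g k _ (powerMap_aux g k), ← Category.assoc]
  apply powerπ_mapHom
  rw [Category.assoc, powerMap_aux g k, ← Category.assoc, powerMap_aux f h, Category.assoc,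
    comp_hom]

end Alg

variable [Preadditive C]

/-- The pro-algebras in `C`: inverse systems of algebras. -/
abbrev ProAlg (C : Type u) [Category.{v} C] [MonoidalCategory C] := ℕ+ᵒᵖ ⥤ Alg C

namespace ProAlg

/-- The multiplication of a pro-algebra, as a map of inverse systems. -/
def towerMul (K : ProAlg C) :
    (K ⋙ Alg.forget C) ⊗ (K ⋙ Alg.forget C) ⟶ K ⋙ Alg.forget C where
  app n := (K.obj n).mul
  naturality _ _ f := (K.map f).map_mul.symm

/-- A pro-algebra in `C`, regarded as an algebra in the category of pro-objects of `C`. -/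
def toAlg (K : ProAlg C) : Alg (ProObj C) where
  X := ⟨K ⋙ Alg.forget C⟩
  mul := levelHom K.towerMul
  assoc := by
    change proComp (proTensor (levelHom K.towerMul) (levelHom (𝟙 (K ⋙ Alg.forget C))))
        (levelHom K.towerMul) = proComp (levelHom (α_ _ _ _).hom)
      (proComp (proTensor (levelHom (𝟙 (K ⋙ Alg.forget C))) (levelHom K.towerMul))
        (levelHom K.towerMul))
    rw [proTensor_levelHom, proTensor_levelHom, levelHom_comp, levelHom_comp, levelHom_comp,
      tensorHom_id, id_tensorHom]
    refine congrArg levelHom ?_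
    ext n
    exact (K.obj n).assoc

/-- The pro-map underlying a homomorphism of inverse systems of algebras. -/
def toProHom {K A : ProAlg C} (i : K ⟶ A) : K.toAlg.X ⟶ A.toAlg.X :=
  (toPro C).map (Functor.whiskerRight i (Alg.forget C))

/-- A homomorphism of inverse systems of algebras `i : K ⟶ A` exhibits `K` as a pro-ideal of
`A` if each `iₙ : Kₙ ⟶ Aₙ` exhibits `Kₙ` as an ideal of `Aₙ`. -/
def IsProIdeal {K A : ProAlg C} (i : K ⟶ A) : Prop :=
  ∀ n : ℕ+ᵒᵖ, IsIdeal (i.app n)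

variable [HasKernels C] [HasCokernels C] [MonoidalPreadditive C]
  [∀ (X : C) ⦃Y Z : C⦄ (f : Y ⟶ Z), PreservesColimit (parallelPair f 0) (tensorLeft X)]

/-- The pro-algebra `K^∞ = {Kₙⁿ : n ≥ 1}`. (Recall that `Alg.power R m` is `R^{m + 1}`.) -/
def infPower (K : ProAlg C) : ProAlg C where
  obj n := (K.obj n).power (n.unop.natPred)
  map {m n} f := Alg.powerMap (K.map f) (PNat.natPred_le_natPred.2 (leOfHom f.unop))
  map_id n := by
    rw [← Alg.powerMap_id (K.obj n) _ le_rfl]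
    congr 1
    exact K.map_id n
  map_comp {m n p} f g := by
    rw [← Alg.powerMap_comp (K.map f) (K.map g) _ _
      (PNat.natPred_le_natPred.2 (leOfHom (f ≫ g).unop))]
    congr 1
    exact K.map_comp f g

/-- The inclusion `K^∞ ⟶ K`. -/
def infPowerIncl (K : ProAlg C) : K.infPower ⟶ K where
  app n := (K.obj n).powerIncl _
  naturality _ _ f := Alg.hom_ext (Alg.powerMapHom_ι (K.map f)
    (PNat.natPred_le_natPred.2 (leOfHom f.unop)))

end ProAlg

end Powers

end CQ

end

open CQ

/-! The heart of the matter is a left linear splitting of the multiplication of `K^∞`: for every `n`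
and suitable `m ≥ n` there is `σ : K_m^m → K_n^n ⊗ K_n^n` which lifts the transition map and
satisfies `σ(xy) = x σ(y)` up to transition maps (`ProAlg.exists_isLinearSplitting`). Applying `σ`
to the last tensor factor is then a contracting homotopy of the bar complex along the transition
maps (`IsLinearSplitting.barD_barHomotopy`).

To find `σ`, fix `n` and let `M` be the constant pro-object on `K_n`, with `A` acting through level
`n`. Since `K → A` is a cofibration, `K → M` extends to a map `f : A → M`. It need not be linear,
but `f(ab) = a f(b)` for `b` in `K`. Quasi-freeness gives `φ` with `φ(ab) = a φ(b) + φ(a) b - da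
db`. Send `r da db` to `Ψ(r da db) = r ⊗ a f(b) - ra ⊗ f(b)` in `Ã ⊗ M`. The action map `Ã ⊗ M → M`
kills the image of `Ψ`, and `Ψ` kills `ω · c` for `c` in `K`. Hence `s(x) = 1 ⊗ f(x) + Ψ(φ(x))` is
an `A`-linear section of the action over `K` (`actSection_linear`). For `x, y` in `K`, `s(xy) = x
s(y)` comes from `K ⊗ M`, so that applying `f` to the first factor yields a map `K → M ⊗ M` which is
a linear splitting, though only on products (`exists_isPartialSplitting`).

Iterating on the left factor gives maps `K_m → K_n^{⊗ j}` which are lifts and linear on `j`-fold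
products (`IsPowerSplitting.succ`). With `j = n`, projecting to `K_n^n` shows that a map from `K^∞`
to a constant object extends to `K`, which is the cofibration claim. With `j = 2n`, cutting the
tensor power into two halves gives `σ`.

The homotopy shows exactness of `Hom(V ⊗ C^bar, c)` for constant `c` only. A relatively injective
pro-object is a retract of the product of its levels (`exists_retraction`), and this carries
exactness over to it (`exists_comp_eq_of_const`). -/

noncomputable section

namespace CQ

namespace Alg

/-! ### The unitization as a bimodule. -/

section Unitization

variable {D : Type u} [Category.{v} D] [Preadditive D] [MonoidalCategory D]
  [HasBinaryBiproducts D] (R : Alg D)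

/-- The inclusion of an algebra in its unitization. -/
def unitizationInl : R.X ⟶ R.unitization := biprod.inl

/-- The unit of the unitization. -/
def unitizationInr : 𝟙_ D ⟶ R.unitization := biprod.inr

/-- The projection of the unitization onto the algebra. -/
def unitizationFst : R.unitization ⟶ R.X := biprod.fst

/-- The augmentation of the unitization. -/
def unitizationSnd : R.unitization ⟶ 𝟙_ D := biprod.snd

@[simp]
lemma unitizationInl_fst : R.unitizationInl ≫ R.unitizationFst = 𝟙 _ := biprod.inl_fst

@[simp]
lemma unitizationInl_snd : R.unitizationInl ≫ R.unitizationSnd = 0 := biprod.inl_snd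

@[simp]
lemma unitizationInr_fst : R.unitizationInr ≫ R.unitizationFst = 0 := biprod.inr_fst

@[simp]
lemma unitizationInr_snd : R.unitizationInr ≫ R.unitizationSnd = 𝟙 _ := biprod.inr_snd

@[simp]
lemma unitizationInl_fst_assoc {X : D} (f : R.X ⟶ X) :
    R.unitizationInl ≫ R.unitizationFst ≫ f = f := by
  rw [← Category.assoc, unitizationInl_fst, Category.id_comp]

lemma mulUnitization_eq : R.mulUnitization =
    (R.X ◁ R.unitizationFst ≫ R.mul + R.X ◁ R.unitizationSnd ≫ (ρ_ R.X).hom) ≫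
      R.unitizationInl := rfl

lemma unitizationMul_eq : R.unitizationMul =
    (R.unitizationFst ▷ R.X ≫ R.mul + R.unitizationSnd ▷ R.X ≫ (λ_ R.X).hom) ≫
      R.unitizationInl := rfl

variable [MonoidalPreadditive D]

lemma inr_unitizationMul :
    R.unitizationInr ▷ R.X ≫ R.unitizationMul = (λ_ R.X).hom ≫ R.unitizationInl := by
  simp only [unitizationMul_eq, Preadditive.add_comp, Preadditive.comp_add, Category.assoc,
    ← comp_whiskerRight_assoc]
  simp

lemma inr_mulUnitization :
    R.X ◁ R.unitizationInr ≫ R.mulUnitization = (ρ_ R.X).hom ≫ R.unitizationInl := by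
  simp only [mulUnitization_eq, Preadditive.add_comp, Preadditive.comp_add, Category.assoc,
    ← MonoidalCategory.whiskerLeft_comp_assoc]
  simp

lemma inl_unitizationMul :
    R.unitizationInl ▷ R.X ≫ R.unitizationMul = R.mul ≫ R.unitizationInl := by
  simp only [unitizationMul_eq, Preadditive.add_comp, Preadditive.comp_add, Category.assoc,
    ← comp_whiskerRight_assoc]
  simp

lemma inl_mulUnitization :
    R.X ◁ R.unitizationInl ≫ R.mulUnitization = R.mul ≫ R.unitizationInl := by
  simp only [mulUnitization_eq, Preadditive.add_comp, Preadditive.comp_add, Category.assoc,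
    ← MonoidalCategory.whiskerLeft_comp_assoc]
  simp

/-- The tensor product is additive in each variable, so it preserves the decomposition of the
unitization, even in a middle factor. -/
lemma unitization_hom_ext {X Y Z : D} {f g : X ⊗ (R.unitization ⊗ Y) ⟶ Z}
    (h : X ◁ R.unitizationInl ▷ Y ≫ f = X ◁ R.unitizationInl ▷ Y ≫ g)
    (h' : X ◁ R.unitizationInr ▷ Y ≫ f = X ◁ R.unitizationInr ▷ Y ≫ g) : f = g := by
  have e : 𝟙 R.unitization = R.unitizationFst ≫ R.unitizationInl +
      R.unitizationSnd ≫ R.unitizationInr := biprod.total.symm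
  have e' : 𝟙 (X ⊗ (R.unitization ⊗ Y)) =
      X ◁ R.unitizationFst ▷ Y ≫ X ◁ R.unitizationInl ▷ Y +
      X ◁ R.unitizationSnd ▷ Y ≫ X ◁ R.unitizationInr ▷ Y := by
    rw [← MonoidalCategory.whiskerLeft_comp, ← MonoidalCategory.whiskerLeft_comp,
      ← comp_whiskerRight, ← comp_whiskerRight, ← MonoidalPreadditive.whiskerLeft_add,
      ← MonoidalPreadditive.add_whiskerRight, ← e]
    simp
  rw [← Category.id_comp f, ← Category.id_comp g, e']
  simp only [Preadditive.add_comp, Category.assoc, h, h']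

lemma unitization_hom_ext' {Y Z : D} {f g : R.unitization ⊗ Y ⟶ Z}
    (h : R.unitizationInl ▷ Y ≫ f = R.unitizationInl ▷ Y ≫ g)
    (h' : R.unitizationInr ▷ Y ≫ f = R.unitizationInr ▷ Y ≫ g) : f = g := by
  rw [← cancel_epi (λ_ _).hom]
  apply R.unitization_hom_ext
  · rw [leftUnitor_naturality_assoc, h, leftUnitor_naturality_assoc]
  · rw [leftUnitor_naturality_assoc, h', leftUnitor_naturality_assoc]

lemma unitizationMul_assoc :
    (α_ R.unitization R.X R.X).inv ≫ R.unitizationMul ▷ R.X ≫ R.unitizationMul =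
      R.unitization ◁ R.mul ≫ R.unitizationMul := by
  apply R.unitization_hom_ext'
  · rw [associator_inv_naturality_left_assoc, ← comp_whiskerRight_assoc, inl_unitizationMul,
      ← whisker_exchange_assoc, inl_unitizationMul, comp_whiskerRight_assoc, inl_unitizationMul,
      reassoc_of% R.assoc_inv]
  · rw [associator_inv_naturality_left_assoc, ← comp_whiskerRight_assoc, inr_unitizationMul,
      ← whisker_exchange_assoc, inr_unitizationMul, comp_whiskerRight_assoc, inl_unitizationMul]
    simp

lemma mulUnitization_unitizationMul :
    (α_ R.X R.unitization R.X).inv ≫ R.mulUnitization ▷ R.X ≫ R.unitizationMul =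
      R.X ◁ R.unitizationMul ≫ R.mulUnitization := by
  apply R.unitization_hom_ext
  · rw [associator_inv_naturality_middle_assoc, ← comp_whiskerRight_assoc, inl_mulUnitization,
      ← MonoidalCategory.whiskerLeft_comp_assoc, inl_unitizationMul,
      comp_whiskerRight_assoc, inl_unitizationMul,
      reassoc_of% R.assoc_inv, MonoidalCategory.whiskerLeft_comp_assoc, inl_mulUnitization]
  · rw [associator_inv_naturality_middle_assoc, ← comp_whiskerRight_assoc, inr_mulUnitization,
      ← MonoidalCategory.whiskerLeft_comp_assoc, inr_unitizationMul,
      comp_whiskerRight_assoc, inl_unitizationMul,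
      MonoidalCategory.whiskerLeft_comp_assoc, inl_mulUnitization]
    simp

end Unitization

/-! ### The map from two-forms to `U ⊗ M`. -/

section Splitting

variable {D : Type u} [Category.{v} D] [Preadditive D] [MonoidalCategory D]
  [MonoidalPreadditive D] {X U M K : D}

/-- The map `r ⊗ (x ⊗ y) ↦ r ⊗ x f(y) - r x ⊗ f(y)`, where `X` acts on `M` by `a` and on `U`
from the right by `m`. -/
def splitMap (m : U ⊗ X ⟶ U) (a : X ⊗ M ⟶ M) (f : X ⟶ M) : U ⊗ (X ⊗ X) ⟶ U ⊗ M :=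
  U ◁ (X ◁ f ≫ a) - U ◁ (X ◁ f) ≫ (α_ U X M).inv ≫ m ▷ M

/-- The map changes `r` only by right multiplication, which commutes with the left action `c` by
`h`. -/
lemma whiskerRight_splitMap {m : U ⊗ X ⟶ U} {c : X ⊗ U ⟶ U} (a : X ⊗ M ⟶ M) (f : X ⟶ M)
    (h : (α_ X U X).inv ≫ c ▷ X ≫ m = X ◁ m ≫ c) :
    ((α_ X U (X ⊗ X)).inv ≫ c ▷ (X ⊗ X)) ≫ splitMap m a f =
      X ◁ splitMap m a f ≫ (α_ X U M).inv ≫ c ▷ M := by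
  have e : X ◁ splitMap m a f = X ◁ (U ◁ (X ◁ f ≫ a)) -
      X ◁ (U ◁ (X ◁ f) ≫ (α_ U X M).inv ≫ m ▷ M) := (tensorLeft X).map_sub
  rw [e, Preadditive.sub_comp, splitMap, Preadditive.comp_sub]
  congr 1
  · rw [Category.assoc, ← whisker_exchange]
    simp
  · have h' := congrArg (fun k => X ◁ U ◁ X ◁ f ≫
      X ◁ (α_ U X M).inv ≫ (α_ _ _ _).inv ≫ k ▷ M) h
    simp only [comp_whiskerRight] at h'
    rw [Category.assoc, ← whisker_exchange_assoc]
    simp at h' ⊢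
    exact h'

/-- For `c` in `K` the three terms of `(r da db) · c` telescope. As `f(bc) = b f(c)`, they
contribute `r ⊗ ab f(c) - ra ⊗ b f(c)`, then `-r ⊗ ab f(c) + rab ⊗ f(c)`, then `ra ⊗ b f(c) - rab ⊗
f(c)`. Linearity of `f` is needed only against `K`, which is all that an extension from `K`
provides. -/
lemma splitMap_right {m : U ⊗ X ⟶ U} {μ : X ⊗ X ⟶ X} {a : X ⊗ M ⟶ M} {f : X ⟶ M}
    {i : K ⟶ X} (hm : (α_ U X X).inv ≫ m ▷ X ≫ m = U ◁ μ ≫ m)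
    (ha : X ◁ a ≫ a = (α_ X X M).inv ≫ μ ▷ M ≫ a)
    (hf : X ◁ i ≫ μ ≫ f = X ◁ (i ≫ f) ≫ a) :
    (U ⊗ (X ⊗ X)) ◁ i ≫ ((α_ U (X ⊗ X) X).hom ≫
    (U ◁ ((α_ X X X).hom ≫ X ◁ μ)
      - U ◁ (μ ▷ X)
      + U ◁ (α_ X X X).hom ≫
          (α_ U X (X ⊗ X)).inv ≫ m ▷ (X ⊗ X))) ≫ splitMap m a f = 0 := by
  have h1 : (U ⊗ (X ⊗ X)) ◁ i ≫ (α_ U (X ⊗ X) X).hom ≫ U ◁ ((α_ X X X).hom ≫ X ◁ μ) ≫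
      U ◁ (X ◁ f) = (U ⊗ (X ⊗ X)) ◁ (i ≫ f) ≫ (α_ _ _ _).hom ≫ U ◁ (α_ _ _ _).hom ≫
        U ◁ X ◁ a := by
    have := congrArg (fun k => (α_ _ _ _).hom ≫ U ◁ (α_ _ _ _).hom ≫ U ◁ X ◁ k) hf
    simp at this ⊢
    exact this
  have h2 : (U ⊗ (X ⊗ X)) ◁ i ≫ (α_ U (X ⊗ X) X).hom ≫ U ◁ (μ ▷ X) ≫
      U ◁ (X ◁ f) = (U ⊗ (X ⊗ X)) ◁ (i ≫ f) ≫ (α_ _ _ _).hom ≫ U ◁ (μ ▷ M) := by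
    rw [← MonoidalCategory.whiskerLeft_comp, ← whisker_exchange]
    simp
  have h3 : (U ⊗ (X ⊗ X)) ◁ i ≫ (α_ U (X ⊗ X) X).hom ≫ U ◁ (α_ X X X).hom ≫
      (α_ U X (X ⊗ X)).inv ≫ m ▷ (X ⊗ X) ≫
      U ◁ (X ◁ f) = (U ⊗ (X ⊗ X)) ◁ (i ≫ f) ≫ (α_ _ _ _).hom ≫ U ◁ (α_ _ _ _).hom ≫
        (α_ _ _ _).inv ≫ m ▷ (X ⊗ M) := by
    rw [← whisker_exchange]
    simp
  have ha' : U ◁ X ◁ a ≫ U ◁ a = U ◁ (α_ X X M).inv ≫ U ◁ μ ▷ M ≫ U ◁ a := by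
    simp only [← MonoidalCategory.whiskerLeft_comp, ha]
  have hm' : (α_ U (X ⊗ X) M).inv ≫ (α_ U X X).inv ▷ M ≫ (m ▷ X) ▷ M ≫ m ▷ M =
      U ◁ μ ▷ M ≫ (α_ _ _ _).inv ≫ m ▷ M := by
    simp only [← comp_whiskerRight, hm]
    simp
  simp only [splitMap, Preadditive.comp_sub, Preadditive.comp_add, Preadditive.add_comp,
    Preadditive.sub_comp, Category.assoc, MonoidalCategory.whiskerLeft_comp U (X ◁ f) a]
  simp only [reassoc_of% h1, reassoc_of% h2, reassoc_of% h3, ha']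
  have e1 : m ▷ (X ⊗ M) ≫ U ◁ a = (U ⊗ X) ◁ a ≫ m ▷ M := (whisker_exchange _ _).symm
  have e2 : (α_ U X (X ⊗ M)).inv ≫ (m ▷ (X ⊗ M)) ≫ (α_ U X M).inv ≫ m ▷ M =
     U ◁ (α_ _ _ _).inv ≫ U ◁ μ ▷ M ≫ (α_ _ _ _).inv ≫ m ▷ M := by
    rw [← hm']
    simp
  rw [e1, e2]
  simp

end Splitting

end Alg

namespace Alg

/-! ### A linear section of the action from quasi-freeness. -/

section QuasiFree

variable {D : Type u} [Category.{v} D] [Preadditive D] [MonoidalCategory D]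
  [MonoidalPreadditive D] [HasBinaryBiproducts D] {R : Alg D} {M K : D}

/-- The action `(R ⊕ k) ⊗ M ⟶ M` induced by an action of `R`. -/
def unitAct (a : R.X ⊗ M ⟶ M) : R.unitization ⊗ M ⟶ M :=
  R.unitizationFst ▷ M ≫ a + R.unitizationSnd ▷ M ≫ (λ_ M).hom

lemma inl_unitAct (a : R.X ⊗ M ⟶ M) : R.unitizationInl ▷ M ≫ unitAct a = a := by
  simp only [unitAct, Preadditive.comp_add, ← comp_whiskerRight_assoc]
  simp

lemma inr_unitAct (a : R.X ⊗ M ⟶ M) : R.unitizationInr ▷ M ≫ unitAct a = (λ_ M).hom := by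
  simp only [unitAct, Preadditive.comp_add, ← comp_whiskerRight_assoc]
  simp

lemma unitizationMul_unitAct {a : R.X ⊗ M ⟶ M}
    (ha : R.X ◁ a ≫ a = (α_ R.X R.X M).inv ≫ R.mul ▷ M ≫ a) :
    (α_ R.unitization R.X M).inv ≫ R.unitizationMul ▷ M ≫ unitAct a =
      R.unitization ◁ a ≫ unitAct a := by
  apply R.unitization_hom_ext'
  · rw [associator_inv_naturality_left_assoc, ← comp_whiskerRight_assoc, inl_unitizationMul,
      ← whisker_exchange_assoc, inl_unitAct, comp_whiskerRight_assoc, inl_unitAct, ha]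
  · rw [associator_inv_naturality_left_assoc, ← comp_whiskerRight_assoc, inr_unitizationMul,
      ← whisker_exchange_assoc, inr_unitAct, comp_whiskerRight_assoc, inl_unitAct]
    simp

/-- The terms `r ⊗ a f(b)` and `ra ⊗ f(b)` differ by moving `a` across the tensor sign, which the
action does not see. -/
lemma splitMap_unitAct {a : R.X ⊗ M ⟶ M} (f : R.X ⟶ M)
    (ha : R.X ◁ a ≫ a = (α_ R.X R.X M).inv ≫ R.mul ▷ M ≫ a) :
    splitMap R.unitizationMul a f ≫ unitAct a = 0 := by
  rw [splitMap, Preadditive.sub_comp, sub_eq_zero]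
  simp only [Category.assoc]
  rw [unitizationMul_unitAct ha, MonoidalCategory.whiskerLeft_comp_assoc]

/-- For a cochain `φ` on `R` with values in two-forms, the map
`x ↦ 1 ⊗ x + ∑ (r ⊗ a x - r a ⊗ x)` obtained from it. -/
def actSection (φ : R.X ⟶ R.unitization ⊗ (R.X ⊗ R.X)) (a : R.X ⊗ M ⟶ M) (f : R.X ⟶ M)
    (i : K ⟶ R.X) : K ⟶ R.unitization ⊗ M :=
  (i ≫ f) ≫ (λ_ M).inv ≫ R.unitizationInr ▷ M + i ≫ φ ≫ splitMap R.unitizationMul a f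

lemma actSection_unitAct (φ : R.X ⟶ R.unitization ⊗ (R.X ⊗ R.X)) {a : R.X ⊗ M ⟶ M} (f : R.X ⟶ M)
    (i : K ⟶ R.X) (ha : R.X ◁ a ≫ a = (α_ R.X R.X M).inv ≫ R.mul ▷ M ≫ a) :
    actSection φ a f i ≫ unitAct a = i ≫ f := by
  simp only [actSection, Preadditive.add_comp, Category.assoc, splitMap_unitAct f ha, inr_unitAct]
  simp

/-- The form `da db` goes to `1 ⊗ a f(b) - a ⊗ f(b)`, exactly the failure of `x ↦ 1 ⊗ f(x)` to be
linear. -/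
lemma dCupD_splitMap {a : R.X ⊗ M ⟶ M} {f : R.X ⟶ M} {i : K ⟶ R.X} :
    R.X ◁ i ≫ ((λ_ (R.X ⊗ R.X)).inv ≫ R.unitizationInr ▷ (R.X ⊗ R.X)) ≫
        splitMap R.unitizationMul a f =
      R.X ◁ (i ≫ f) ≫ a ≫ (λ_ M).inv ≫ R.unitizationInr ▷ M -
        R.X ◁ (i ≫ f) ≫ R.unitizationInl ▷ M := by
  rw [splitMap]
  simp only [Preadditive.comp_sub, Category.assoc]
  rw [← whisker_exchange, ← whisker_exchange_assoc, associator_inv_naturality_left_assoc,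
    ← comp_whiskerRight, inr_unitizationMul]
  simp

/-- Write `Ψ` for `splitMap`. For `y` in `K`, `φ(xy) = x φ(y) + φ(x) y - dx dy`. Here `Ψ` kills
`φ(x) y`, and `-Ψ(dx dy) = x ⊗ f(y) - 1 ⊗ x f(y)` replaces the leading term `1 ⊗ x f(y)` of the
value at `xy` by `x ⊗ f(y)`. What remains is `x` times the value at `y`. -/
lemma actSection_linear {φ : R.X ⟶ R.unitization ⊗ (R.X ⊗ R.X)} (hφ : R.coboundary φ = R.dCupD)
    {a : R.X ⊗ M ⟶ M} {f : R.X ⟶ M} {i : K ⟶ R.X}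
    (ha : R.X ◁ a ≫ a = (α_ R.X R.X M).inv ≫ R.mul ▷ M ≫ a)
    (hf : R.X ◁ i ≫ R.mul ≫ f = R.X ◁ (i ≫ f) ≫ a)
    {l : R.X ⊗ K ⟶ K} (hl : l ≫ i = R.X ◁ i ≫ R.mul) :
    l ≫ actSection φ a f i = R.X ◁ actSection φ a f i ≫
      (α_ R.X R.unitization M).inv ≫ R.mulUnitization ▷ M := by
  have e : R.mul ≫ φ = R.X ◁ φ ≫ ((α_ R.X R.unitization (R.X ⊗ R.X)).inv ≫
      R.mulUnitization ▷ (R.X ⊗ R.X)) + φ ▷ R.X ≫ ((α_ R.unitization (R.X ⊗ R.X) R.X).hom ≫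
    (R.unitization ◁ ((α_ R.X R.X R.X).hom ≫ R.X ◁ R.mul)
      - R.unitization ◁ (R.mul ▷ R.X)
      + R.unitization ◁ (α_ R.X R.X R.X).hom ≫
          (α_ R.unitization R.X (R.X ⊗ R.X)).inv ≫ R.unitizationMul ▷ (R.X ⊗ R.X))) -
      (λ_ (R.X ⊗ R.X)).inv ≫ R.unitizationInr ▷ (R.X ⊗ R.X) := by
    rw [eq_sub_iff_add_eq', ← eq_sub_iff_add_eq, add_sub_right_comm]
    exact hφ.symm
  have e1 : R.X ◁ actSection φ a f i = R.X ◁ ((i ≫ f) ≫ (λ_ M).inv ≫ R.unitizationInr ▷ M) +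
    R.X ◁ (i ≫ φ ≫ splitMap R.unitizationMul a f) := MonoidalPreadditive.whiskerLeft_add _ _
  have e2 : l ≫ (i ≫ f) ≫ (λ_ M).inv ≫ R.unitizationInr ▷ M =
      R.X ◁ (i ≫ f) ≫ a ≫ (λ_ M).inv ≫ R.unitizationInr ▷ M := by
    simp only [Category.assoc, reassoc_of% hl, reassoc_of% hf]
  have e3 : R.X ◁ ((i ≫ f) ≫ (λ_ M).inv ≫ R.unitizationInr ▷ M) ≫
      (α_ R.X R.unitization M).inv ≫ R.mulUnitization ▷ M =
        R.X ◁ (i ≫ f) ≫ R.unitizationInl ▷ M := by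
    simp only [MonoidalCategory.whiskerLeft_comp, Category.assoc]
    rw [associator_inv_naturality_middle_assoc, ← comp_whiskerRight, inr_mulUnitization]
    simp
  have e4 : R.X ◁ i ≫ φ ▷ R.X = φ ▷ K ≫ (R.unitization ⊗ (R.X ⊗ R.X)) ◁ i :=
    whisker_exchange _ _
  rw [e1, actSection, Preadditive.comp_add, e2, reassoc_of% hl, reassoc_of% e, Preadditive.sub_comp,
    Preadditive.add_comp, Preadditive.comp_sub, Preadditive.comp_add, dCupD_splitMap,
    Category.assoc (φ ▷ R.X), reassoc_of% e4, splitMap_right R.unitizationMul_assoc ha hf,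
    comp_zero, add_zero, Category.assoc (R.X ◁ φ),
    whiskerRight_splitMap a f R.mulUnitization_unitizationMul, Preadditive.add_comp, e3]
  simp only [MonoidalCategory.whiskerLeft_comp, Category.assoc]
  abel

/-- The projection of `actSection` to `M ⊗ M`. -/
def splitting (φ : R.X ⟶ R.unitization ⊗ (R.X ⊗ R.X)) (a : R.X ⊗ M ⟶ M) (f : R.X ⟶ M)
    (i : K ⟶ R.X) : K ⟶ M ⊗ M :=
  actSection φ a f i ≫ (R.unitizationFst ≫ f) ▷ M

section

variable {φ : R.X ⟶ R.unitization ⊗ (R.X ⊗ R.X)} (hφ : R.coboundary φ = R.dCupD)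
    {a : R.X ⊗ M ⟶ M} {f : R.X ⟶ M} {i : K ⟶ R.X}
    (ha : R.X ◁ a ≫ a = (α_ R.X R.X M).inv ≫ R.mul ▷ M ≫ a)
    (hf : R.X ◁ i ≫ R.mul ≫ f = R.X ◁ (i ≫ f) ≫ a)
    {l : R.X ⊗ K ⟶ K} (hl : l ≫ i = R.X ◁ i ≫ R.mul)
    {r : K ⊗ R.X ⟶ K} (hr : r ≫ i = i ▷ R.X ≫ R.mul)

include hφ ha hf hl hr

/-- By linearity the value at `xy` is `x` times the value at `y`, and `x Ã` lies in `K` because `K`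
is also a right ideal. This removes the summand `k` of the unitization. -/
lemma exists_actSection_factor : ∃ w : K ⊗ K ⟶ K ⊗ M,
    i ▷ K ≫ l ≫ actSection φ a f i = w ≫ (i ≫ R.unitizationInl) ▷ M := by
  refine ⟨K ◁ actSection φ a f i ≫ (α_ _ _ _).inv ≫
    (K ◁ R.unitizationFst ≫ r + K ◁ R.unitizationSnd ≫ (ρ_ K).hom) ▷ M, ?_⟩
  have e : i ▷ R.unitization ≫ R.mulUnitization =
      (K ◁ R.unitizationFst ≫ r + K ◁ R.unitizationSnd ≫ (ρ_ K).hom) ≫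
        i ≫ R.unitizationInl := by
    simp only [mulUnitization_eq, Preadditive.add_comp, Preadditive.comp_add, Category.assoc,
      reassoc_of% hr]
    rw [whisker_exchange_assoc, ← rightUnitor_naturality_assoc, whisker_exchange_assoc]
  rw [actSection_linear hφ ha hf hl, ← whisker_exchange_assoc,
    associator_inv_naturality_left_assoc, ← comp_whiskerRight, e]
  simp only [Category.assoc, comp_whiskerRight]

/-- Dropping the summand `k` loses nothing on products, where the section already takes values in `K
⊗ M`. Multiplying in `M` therefore agrees there with the action, of which `actSection` is a section.
-/
lemma splitting_mul {m : M ⊗ M ⟶ M} (hm : (i ≫ f) ▷ M ≫ m = i ▷ M ≫ a) :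
    i ▷ K ≫ l ≫ splitting φ a f i ≫ m = i ▷ K ≫ l ≫ i ≫ f := by
  obtain ⟨w, hw⟩ := exists_actSection_factor hφ ha hf hl hr
  have h : i ▷ K ≫ l ≫ splitting φ a f i = w ≫ (i ≫ f) ▷ M := by
    rw [splitting, reassoc_of% hw, ← comp_whiskerRight, Category.assoc, unitizationInl_fst_assoc]
  rw [reassoc_of% h, hm, ← actSection_unitAct φ f i ha, reassoc_of% hw, comp_whiskerRight_assoc,
    inl_unitAct]

/-- The section itself is linear, but the map `f` applied to its first factor is linear only on `K`.
So the argument `yz` must itself be a product of elements of `K`, to have its value in `K ⊗ M`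
before `x` acts. -/
lemma splitting_linear :
    K ◁ (i ▷ K ≫ l) ≫ i ▷ K ≫ l ≫ splitting φ a f i =
      K ◁ (i ▷ K ≫ l ≫ splitting φ a f i) ≫ i ▷ (M ⊗ M) ≫ (α_ _ _ _).inv ≫ a ▷ M := by
  obtain ⟨w, hw⟩ := exists_actSection_factor hφ ha hf hl hr
  have h : i ▷ K ≫ l ≫ splitting φ a f i = w ≫ (i ≫ f) ▷ M := by
    rw [splitting, reassoc_of% hw, ← comp_whiskerRight, Category.assoc, unitizationInl_fst_assoc]
  rw [whisker_exchange_assoc]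
  conv_rhs => rw [h]
  rw [splitting, reassoc_of% (actSection_linear hφ ha hf hl),
    ← MonoidalCategory.whiskerLeft_comp_assoc, Category.assoc, hw, whisker_exchange_assoc]
  simp only [MonoidalCategory.whiskerLeft_comp, Category.assoc, comp_whiskerRight]
  have key : R.X ◁ i ≫ R.X ◁ R.unitizationInl ≫ R.mulUnitization ≫ R.unitizationFst ≫ f =
      R.X ◁ i ≫ R.X ◁ f ≫ a := by
    rw [reassoc_of% R.inl_mulUnitization, R.unitizationInl_fst_assoc, hf,
      MonoidalCategory.whiskerLeft_comp_assoc]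
  have key' := congrArg (fun k => (α_ R.X K M).inv ≫ k ▷ M) key
  simp only [comp_whiskerRight, ← associator_inv_naturality_middle_assoc] at key'
  rw [key']

end

end QuasiFree
end Alg

/-! ### Representing pro-maps by maps between levels. -/

section Representatives

variable {C : Type u} [Category.{v} C] [Preadditive C]

lemma ColimHom.mk_map {X : Tower C} {c : C} {i j : ℕ+} (e : op j ⟶ op i) (f : X.obj (op i) ⟶ c) :
    ColimHom.mk j (X.map e ≫ f) = ColimHom.mk i f :=
  ColimHom.mk_trans (leOfHom e.unop) f

lemma ColimHom.mk_eq_mk {X : Tower C} {c : C} {i j : ℕ+} {f : X.obj (op i) ⟶ c}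
    {g : X.obj (op j) ⟶ c} (h : ColimHom.mk i f = ColimHom.mk j g) :
    ∃ (k : ℕ+) (e : op k ⟶ op i) (e' : op k ⟶ op j), X.map e ≫ f = X.map e' ≫ g := by
  obtain ⟨k, hi, hj, h⟩ := Quotient.eq.1 h
  exact ⟨k, (homOfLE hi).op, (homOfLE hj).op, h⟩

lemma ColimHom.exists_mk_ge {X : Tower C} {c : C} (x : ColimHom X c) (n : ℕ+) :
    ∃ (m : ℕ+) (_ : op m ⟶ op n) (f : X.obj (op m) ⟶ c), x = ColimHom.mk m f := by
  induction x using ColimHom.ind with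
  | h i f =>
    exact ⟨max i n, (homOfLE (le_max_right i n)).op, _,
      (ColimHom.mk_map (homOfLE (le_max_left i n)).op f).symm⟩

/-- The map `g : Xₘ ⟶ Yₙ` represents the `n`-th component of the map `f` of pro-objects. -/
def IsRep {X Y : ProObj C} (f : X ⟶ Y) (n m : ℕ+) (g : X.tower.obj (op m) ⟶ Y.tower.obj (op n)) :
    Prop :=
  Subtype.val (show proHom X.tower Y.tower from f) n = ColimHom.mk m g

namespace IsRep

lemma exists_ge {X Y : ProObj C} (f : X ⟶ Y) (n k : ℕ+) :
    ∃ (m : ℕ+) (_ : op m ⟶ op k) (g : _), IsRep f n m g :=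
  ColimHom.exists_mk_ge _ k

variable {X Y Z : ProObj C} {f : X ⟶ Y} {n m k : ℕ+}
  {g : X.tower.obj (op m) ⟶ Y.tower.obj (op n)}

lemma precomp_map (h : IsRep f n m g) (e : op k ⟶ op m) : IsRep f n k (X.tower.map e ≫ g) :=
  Eq.trans h (ColimHom.mk_map e g).symm

lemma comp {f' : Y ⟶ Z} {k : ℕ+} {g' : Y.tower.obj (op n) ⟶ Z.tower.obj (op k)}
    (h : IsRep f n m g) (h' : IsRep f' k n g') : IsRep (f ≫ f') k m (g ≫ g') := by
  change proPrecomp (show proHom X.tower Y.tower from f) _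
    (Subtype.val (show proHom Y.tower Z.tower from f') k) = _
  rw [show Subtype.val (show proHom Y.tower Z.tower from f') k = _ from h', proPrecomp_mk,
    show Subtype.val (show proHom X.tower Y.tower from f) n = _ from h, ColimHom.push_mk]

lemma toPro_map {X Y : Tower C} (f : X ⟶ Y) (n : ℕ+) : IsRep ((toPro C).map f) n n (f.app (op n)) :=
  rfl

lemma id (X : ProObj C) (e : op m ⟶ op n) : IsRep (𝟙 X) n m (X.tower.map e) := by
  have := precomp_map (toPro_map (𝟙 X.tower) n) e
  rw [NatTrans.id_app] at this
  exact Eq.trans this (congrArg _ (Category.comp_id _))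

lemma congr {g' : X.tower.obj (op m) ⟶ Y.tower.obj (op n)} (h : IsRep f n m g) (e : g = g') :
    IsRep f n m g' :=
  Eq.trans h (congrArg _ e)

lemma hom_ext {f f' : X ⟶ Y} (h : ∀ n, ∃ (m : ℕ+) (g : _), IsRep f n m g ∧ IsRep f' n m g) :
    f = f' :=
  Subtype.ext (funext fun n => by
    obtain ⟨m, g, h, h'⟩ := h n
    exact Eq.trans h h'.symm)

lemma eventually_eq {m' : ℕ+} {g' : X.tower.obj (op m') ⟶ Y.tower.obj (op n)}
    (h : IsRep f n m g) (h' : IsRep f n m' g') :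
    ∃ (k : ℕ+) (e : op k ⟶ op m) (e' : op k ⟶ op m'),
      X.tower.map e ≫ g = X.tower.map e' ≫ g' :=
  ColimHom.mk_eq_mk (Eq.trans h.symm h')

variable [MonoidalCategory C]

lemma tensorHom {X' Y' : ProObj C} {f' : X' ⟶ Y'}
    {g' : X'.tower.obj (op m) ⟶ Y'.tower.obj (op n)} (h : IsRep f n m g) (h' : IsRep f' n m g') :
    IsRep (f ⊗ₘ f') n m (g ⊗ₘ g') := by
  change colimTensor (Subtype.val (show proHom X.tower Y.tower from f) n)
    (Subtype.val (show proHom X'.tower Y'.tower from f') n) = _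
  rw [show Subtype.val (show proHom X'.tower Y'.tower from f') n = _ from h',
    show Subtype.val (show proHom X.tower Y.tower from f) n = _ from h]
  exact colimTensor_mk _ _ _

lemma whiskerLeft (h : IsRep f n m g) (e : op m ⟶ op n) (Z : ProObj C) :
    IsRep (Z ◁ f) n m (Z.tower.map e ⊗ₘ g) := by
  rw [← id_tensorHom]
  exact (id Z e).tensorHom h

lemma whiskerRight (h : IsRep f n m g) (e : op m ⟶ op n) (Z : ProObj C) :
    IsRep (f ▷ Z) n m (g ⊗ₘ Z.tower.map e) := by
  rw [← tensorHom_id]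
  exact h.tensorHom (id Z e)

lemma whiskerLeft_self {g : X.tower.obj (op n) ⟶ Y.tower.obj (op n)} (h : IsRep f n n g)
    (Z : ProObj C) : IsRep (Z ◁ f) n n (Z.tower.obj (op n) ◁ g) := by
  have := h.whiskerLeft (𝟙 _) Z
  rw [CategoryTheory.Functor.map_id] at this
  exact Eq.trans this (congrArg _ (id_tensorHom _ _))

lemma whiskerRight_self {g : X.tower.obj (op n) ⟶ Y.tower.obj (op n)} (h : IsRep f n n g)
    (Z : ProObj C) : IsRep (f ▷ Z) n n (g ▷ Z.tower.obj (op n)) := by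
  have := h.whiskerRight (𝟙 _) Z
  rw [CategoryTheory.Functor.map_id] at this
  exact Eq.trans this (congrArg _ (tensorHom_id _ _))

end IsRep

/-- The map from a pro-object to a constant pro-object given by a class of maps. -/
def toConst {X : ProObj C} {c : C} (x : ColimHom X.tower c) : X ⟶ (constPro C).obj c :=
  show proHom X.tower ((Functor.const ℕ+ᵒᵖ).obj c) from
    ⟨fun _ => x, fun _ _ _ => ColimHom.push_id x⟩

lemma constPro_val {X : ProObj C} {c : C} (f : X ⟶ (constPro C).obj c) (m n : ℕ+) :
    Subtype.val (show proHom X.tower ((Functor.const ℕ+ᵒᵖ).obj c) from f) m =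
      Subtype.val (show proHom X.tower ((Functor.const ℕ+ᵒᵖ).obj c) from f) n := by
  have key : ∀ (m n : ℕ+), m ≤ n →
      Subtype.val (show proHom X.tower ((Functor.const ℕ+ᵒᵖ).obj c) from f) m =
      Subtype.val (show proHom X.tower ((Functor.const ℕ+ᵒᵖ).obj c) from f) n := fun m n h =>
    ((Subtype.property (show proHom X.tower ((Functor.const ℕ+ᵒᵖ).obj c) from f) m n h).symm.trans
      (ColimHom.push_id _))
  rcases le_total m n with h | h
  · exact key m n h
  · exact (key n m h).symm

/-- All components of a map into a constant pro-object coincide, so a common representative of one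
component suffices. -/
lemma constPro_hom_ext {X : ProObj C} {c : C} {f g : X ⟶ (constPro C).obj c} {n m : ℕ+}
    {h : X.tower.obj (op m) ⟶ c} (hf : IsRep f n m h) (hg : IsRep g n m h) : f = g :=
  Subtype.ext (funext fun k =>
    (constPro_val f k n).trans ((Eq.trans hf hg.symm).trans (constPro_val g n k)))

lemma isRep_toConst {X : ProObj C} {c : C} (n m : ℕ+) (f : X.tower.obj (op m) ⟶ c) :
    IsRep (toConst (ColimHom.mk m f)) n m f := rfl

lemma toConst_surjective {X : ProObj C} {c : C} (f : X ⟶ (constPro C).obj c) :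
    ∃ (m : ℕ+) (g : X.tower.obj (op m) ⟶ c), f = toConst (ColimHom.mk m g) := by
  obtain ⟨m, _, g, h⟩ := IsRep.exists_ge f 1 1
  exact ⟨m, g, constPro_hom_ext h (isRep_toConst 1 m g)⟩

end Representatives

/-! ### Partial splittings at finite levels. -/

section KeyLemma

variable {C : Type u} [Category.{v} C] [Preadditive C] [MonoidalCategory C]

/-- For a homomorphism `t : S ⟶ R`, a map `s : S ⟶ R ⊗ R` is a partial splitting if it lifts `t`
on products, and if it is left linear on products. -/
structure Alg.IsPartialSplitting {S R : Alg C} (t : S ⟶ R) (s : S.X ⟶ R.X ⊗ R.X) : Prop where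
  mul : S.mul ≫ s ≫ R.mul = S.mul ≫ t.hom
  linear : S.X ◁ S.mul ≫ S.mul ≫ s = (t.hom ⊗ₘ (S.mul ≫ s)) ≫ R.freeAct R.X

lemma ProAlg.map_naturality {K A : ProAlg C} (i : K ⟶ A) {m n : ℕ+ᵒᵖ} (e : m ⟶ n) :
    (K.map e).hom ≫ (i.app n).hom = (i.app m).hom ≫ (A.map e).hom :=
  congrArg Alg.Hom.hom (i.naturality e)

variable [MonoidalPreadditive C] [HasBinaryBiproducts C]

/-- The abstract construction is run in the pro-category with values in the constant object on
`K_n`. The resulting identities of pro-maps become identities in the base category at a deep enough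
level. -/
theorem ProAlg.exists_isPartialSplitting {A K : ProAlg C} (hA : A.toAlg.IsQuasiFree) (i : K ⟶ A)
    (hi : ProAlg.IsProIdeal i) (n : ℕ+)
    (hcof : ∃ f : A.toAlg.X ⟶ (constPro C).obj (K.obj (op n)).X,
      ProAlg.toProHom i ≫ f = toConst (ColimHom.mk n (𝟙 _))) :
    ∃ (m : ℕ+) (e : op m ⟶ op n) (s : _), Alg.IsPartialSplitting (K.map e) s := by
  obtain ⟨φ, hφ⟩ := hA
  obtain ⟨f, hf⟩ := hcof
  choose l hl using fun k => (hi k).left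
  choose r hr using fun k => (hi k).right
  have hmono := fun k => (hi k).mono
  -- The actions of `A` on `K` are chosen level by level; they are compatible with transition maps
  -- because each inclusion is mono.
  let lT : (A ⋙ Alg.forget C) ⊗ (K ⋙ Alg.forget C) ⟶ K ⋙ Alg.forget C :=
    { app := l
      naturality := fun p q e => by
        change ((A.map e).hom ⊗ₘ (K.map e).hom) ≫ l q = l p ≫ (K.map e).hom
        rw [← cancel_mono (i.app q).hom, Category.assoc, hl, Category.assoc,
          map_naturality i e, reassoc_of% (hl p), (A.map e).map_mul, ← id_tensorHom,
          ← id_tensorHom, tensorHom_comp_tensorHom_assoc, tensorHom_comp_tensorHom_assoc,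
          map_naturality i e, Category.comp_id, Category.id_comp] }
  let rT : (K ⋙ Alg.forget C) ⊗ (A ⋙ Alg.forget C) ⟶ K ⋙ Alg.forget C :=
    { app := r
      naturality := fun p q e => by
        change ((K.map e).hom ⊗ₘ (A.map e).hom) ≫ r q = r p ≫ (K.map e).hom
        rw [← cancel_mono (i.app q).hom, Category.assoc, hr, Category.assoc,
          map_naturality i e, reassoc_of% (hr p), (A.map e).map_mul, ← tensorHom_id,
          ← tensorHom_id, tensorHom_comp_tensorHom_assoc, tensorHom_comp_tensorHom_assoc,
          map_naturality i e, Category.comp_id, Category.id_comp] }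
  -- The target must be constant for the cofibration to give the extension `f`; the action and
  -- product on it are those of level `n`.
  let M : ProObj C := (constPro C).obj (K.obj (op n)).X
  let p : K.toAlg.X ⟶ M := toConst (ColimHom.mk n (𝟙 _))
  have repp : IsRep p n n (𝟙 (K.obj (op n)).X) := isRep_toConst n n _
  replace hf : toProHom i ≫ f = p := hf
  let a : A.toAlg.X ⊗ M ⟶ M := toConst (ColimHom.mk n (l (op n)))
  let mM : M ⊗ M ⟶ M := toConst (ColimHom.mk n (K.obj (op n)).mul)
  let L : A.toAlg.X ⊗ K.toAlg.X ⟶ K.toAlg.X := (toPro C).map lT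
  let Rr : K.toAlg.X ⊗ A.toAlg.X ⟶ K.toAlg.X := (toPro C).map rT
  have repI : ∀ k, IsRep (toProHom i) k k (i.app (op k)).hom := fun k => IsRep.toPro_map _ k
  have repA : ∀ k, IsRep A.toAlg.mul k k (A.obj (op k)).mul := fun k => IsRep.toPro_map _ k
  have repL : ∀ k, IsRep L k k (l (op k)) := fun k => IsRep.toPro_map _ k
  have repR : ∀ k, IsRep Rr k k (r (op k)) := fun k => IsRep.toPro_map _ k
  have repa : IsRep a n n (l (op n)) := isRep_toConst n n _
  have repm : IsRep mM n n (K.obj (op n)).mul := isRep_toConst n n _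
  have hil : ∀ k, (i.app k).hom ▷ (K.obj k).X ≫ l k = (K.obj k).mul := fun k => by
    rw [← cancel_mono (i.app k).hom, Category.assoc, hl, (i.app k).map_mul,
      MonoidalCategory.tensorHom_def, Category.assoc]
  -- The action on `K_n` is associative because it becomes multiplication in `A_n` after the mono
  -- inclusion.
  have hll : (A.obj (op n)).X ◁ l (op n) ≫ l (op n) = (α_ _ _ _).inv ≫
      (A.obj (op n)).mul ▷ (K.obj (op n)).X ≫ l (op n) := by
    rw [← cancel_mono (i.app (op n)).hom]
    simp only [Category.assoc, hl]
    rw [← MonoidalCategory.whiskerLeft_comp_assoc, hl, ← whisker_exchange_assoc,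
      MonoidalCategory.whiskerLeft_comp_assoc, ← Alg.assoc_inv]
    simp
  have hL : L ≫ toProHom i = A.toAlg.X ◁ toProHom i ≫ A.toAlg.mul :=
    IsRep.hom_ext fun k => ⟨k, _, ((repL k).comp (repI k)).congr (hl _),
      ((repI k).whiskerLeft_self A.toAlg.X).comp (repA k)⟩
  have hR : Rr ≫ toProHom i = toProHom i ▷ A.toAlg.X ≫ A.toAlg.mul :=
    IsRep.hom_ext fun k => ⟨k, _, ((repR k).comp (repI k)).congr (hr _),
      ((repI k).whiskerRight_self A.toAlg.X).comp (repA k)⟩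
  have ha : A.toAlg.X ◁ a ≫ a = (α_ A.toAlg.X A.toAlg.X M).inv ≫ A.toAlg.mul ▷ M ≫ a :=
    constPro_hom_ext (((repa.whiskerLeft_self A.toAlg.X).comp repa).congr hll)
      ((IsRep.toPro_map (α_ A.toAlg.X.tower A.toAlg.X.tower M.tower).inv n).comp
        (((repA n).whiskerRight_self M).comp repa))
  have hlin : A.toAlg.X ◁ toProHom i ≫ A.toAlg.mul ≫ f = A.toAlg.X ◁ (toProHom i ≫ f) ≫ a := by
    rw [← reassoc_of% hL, hf]
    exact constPro_hom_ext (((repL n).comp repp).congr (Category.comp_id _))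
      (((repp.whiskerLeft_self A.toAlg.X).comp repa).congr
        ((congrArg (fun k => k ≫ l (op n)) (whiskerLeft_id _ _)).trans (Category.id_comp _)))
  have hm : (toProHom i ≫ f) ▷ M ≫ mM = toProHom i ▷ M ≫ a := by
    rw [hf]
    exact constPro_hom_ext (((repp.whiskerRight_self M).comp repm).congr
      (((congrArg (fun k => k ≫ (K.obj (op n)).mul) (id_whiskerRight _ _)).trans
        (Category.id_comp _)).trans (hil (op n)).symm))
      (((repI n).whiskerRight_self M).comp repa)
  have h1 := Alg.splitting_mul hφ ha hlin hL hR hm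
  have h2 := Alg.splitting_linear hφ ha hlin hL hR
  rw [hf] at h1
  generalize Alg.splitting φ a f (toProHom i) = σ at h1 h2
  obtain ⟨m, e, s, hs⟩ : ∃ (m : ℕ+) (_ : op m ⟶ op n)
    (s : (K.obj (op m)).X ⟶ (K.obj (op n)).X ⊗ (K.obj (op n)).X), IsRep σ n m s :=
    IsRep.exists_ge σ n n
  have hmul : toProHom i ▷ K.toAlg.X ≫ L = K.toAlg.mul :=
    IsRep.hom_ext fun k => ⟨k, _, (((repI k).whiskerRight_self K.toAlg.X).comp (repL k)).congr
      (hil _), IsRep.toPro_map _ k⟩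
  have hmulσ : toProHom i ▷ K.toAlg.X ≫ L ≫ σ = K.toAlg.mul ≫ σ := by
    rw [← hmul, Category.assoc]
  rw [reassoc_of% hmul, reassoc_of% hmul] at h1
  rw [hmulσ, hmul] at h2
  have repK : ∀ k, IsRep K.toAlg.mul k k (K.obj (op k)).mul := fun k => IsRep.toPro_map _ k
  have rep1 : IsRep (K.toAlg.mul ≫ σ ≫ mM) n n (K.obj (op n)).mul := by
    rw [h1]
    exact ((repK n).comp repp).congr (Category.comp_id _)
  have rep2 : IsRep (K.toAlg.X ◁ K.toAlg.mul ≫ K.toAlg.mul ≫ σ) n m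
      (((K.map e).hom ⊗ₘ ((K.obj (op m)).mul ≫ s)) ≫ (K.obj (op n)).freeAct _) := by
    rw [h2]
    refine ((((repK m).comp hs).whiskerLeft e K.toAlg.X).comp
      (((repI n).whiskerRight_self (M ⊗ M)).comp ((IsRep.toPro_map
        (α_ A.toAlg.X.tower M.tower M.tower).inv n).comp (repa.whiskerRight_self M)))).congr ?_
    refine congrArg (fun k => ((K.map e).hom ⊗ₘ ((K.obj (op m)).mul ≫ s)) ≫ k) ?_
    refine (associator_inv_naturality_left_assoc _ _ _ _).trans ?_
    refine (congrArg (fun k => (α_ _ _ _).inv ≫ k) ((comp_whiskerRight _ _ _).symm)).trans ?_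
    exact congrArg (fun k => (α_ _ _ _).inv ≫ k ▷ (K.obj (op n)).X) (hil (op n))
  -- Two representatives of one component agree after restriction to a deeper level. This is applied
  -- to the lifting property and to linearity separately; `q` lies beyond both levels, and the
  -- representative `s` is pulled back to it.
  obtain ⟨k, e1, e2, hk⟩ := IsRep.eventually_eq ((repK m).comp (hs.comp repm)) rep1
  obtain ⟨k', e3, e4, hk'⟩ := IsRep.eventually_eq (((repK m).whiskerLeft_self K.toAlg.X).comp
    ((repK m).comp hs)) rep2
  obtain rfl : e3 = e4 := Subsingleton.elim _ _
  replace hk : ((K.map e1).hom ⊗ₘ (K.map e1).hom) ≫ (K.obj (op m)).mul ≫ s ≫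
      (K.obj (op n)).mul = ((K.map e2).hom ⊗ₘ (K.map e2).hom) ≫ (K.obj (op n)).mul := hk
  replace hk' : ((K.map e3).hom ⊗ₘ ((K.map e3).hom ⊗ₘ (K.map e3).hom)) ≫
      (K.obj (op m)).X ◁ (K.obj (op m)).mul ≫ (K.obj (op m)).mul ≫ s =
      ((K.map e3).hom ⊗ₘ ((K.map e3).hom ⊗ₘ (K.map e3).hom)) ≫
        ((K.map e).hom ⊗ₘ ((K.obj (op m)).mul ≫ s)) ≫ (K.obj (op n)).freeAct _ := hk'
  let q := max k k'
  let d : op q ⟶ op k := (homOfLE (le_max_left k k')).op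
  let d' : op q ⟶ op k' := (homOfLE (le_max_right k k')).op
  obtain ⟨w, hw⟩ : ∃ w, w = d ≫ e1 := ⟨_, rfl⟩
  have hw2 : w ≫ e = d ≫ e2 := Subsingleton.elim _ _
  have hw3 : w = d' ≫ e3 := Subsingleton.elim _ _
  refine ⟨q, w ≫ e, (K.map w).hom ≫ s, ⟨?_, ?_⟩⟩
  · have h := congrArg (fun x => ((K.map d).hom ⊗ₘ (K.map d).hom) ≫ x) hk
    simp only [tensorHom_comp_tensorHom_assoc, ← Alg.comp_hom, ← Functor.map_comp, ← hw,
      ← hw2] at h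
    rw [reassoc_of% (K.map w).map_mul.symm] at h
    rw [Category.assoc, (K.map (w ≫ e)).map_mul, h]
  · have h := congrArg (fun x => ((K.map d').hom ⊗ₘ ((K.map d').hom ⊗ₘ (K.map d').hom)) ≫ x) hk'
    simp only [tensorHom_comp_tensorHom_assoc, ← Alg.comp_hom, ← Functor.map_comp, ← hw3] at h
    have hw4 : d' ≫ e3 ≫ e = w ≫ e := Subsingleton.elim _ _
    rw [← id_tensorHom, tensorHom_comp_tensorHom_assoc, Category.comp_id,
      tensorHom_comp_tensorHom, ← Alg.comp_hom, ← Functor.map_comp, ← hw3,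
      ← (K.map w).map_mul, hw4,
      reassoc_of% (K.map w).map_mul.symm] at h
    have h3 : (K.map w).hom ⊗ₘ ((K.obj (op q)).mul ≫ (K.map w).hom) =
      (K.obj (op q)).X ◁ (K.obj (op q)).mul ≫ ((K.map w).hom ⊗ₘ (K.map w).hom) := by
      rw [← id_tensorHom, tensorHom_comp_tensorHom, Category.id_comp]
    rw [h3, Category.assoc, reassoc_of% (K.map w).map_mul.symm] at h
    exact h

end KeyLemma

namespace Alg

/-! ### Iterating the splitting into tensor powers. -/

section PowerSplitting

variable {C : Type u} [Category.{v} C] [MonoidalCategory C]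

/-- A map `τ : S ⟶ R^{⊗ (j + 1)}` which lifts the homomorphism `t : S ⟶ R` on products of `j + 1`
factors, and which is left linear on such products. -/
structure IsPowerSplitting {S R : Alg C} (t : S ⟶ R) (j : ℕ) (τ : S.X ⟶ R.pow j) : Prop where
  mul : S.mulPow j ≫ τ ≫ R.mulPow j = S.mulPow j ≫ t.hom
  linear : S.X ◁ S.mulPow j ≫ S.mul ≫ τ = (t.hom ⊗ₘ (S.mulPow j ≫ τ)) ≫ R.act j

lemma isPowerSplitting_zero {S R : Alg C} (t : S ⟶ R) : IsPowerSplitting t 0 t.hom where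
  mul := congrArg (fun k => 𝟙 _ ≫ k) (Category.comp_id _)
  linear := by
    change S.X ◁ 𝟙 S.X ≫ S.mul ≫ t.hom = (t.hom ⊗ₘ (𝟙 S.X ≫ t.hom)) ≫ R.mul
    rw [whiskerLeft_id, Category.id_comp, Category.id_comp, t.map_mul]

/-- The isomorphism `R^{⊗ (n + 1)} ⊗ R ⟶ R^{⊗ (n + 2)}`. -/
def snoc (R : Alg C) : ∀ n : ℕ, R.pow n ⊗ R.X ⟶ R.X ⊗ R.pow n
  | 0 => 𝟙 (R.X ⊗ R.X)
  | n + 1 => (α_ R.X (R.pow n) R.X).hom ≫ R.X ◁ snoc R n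

lemma snoc_mulPow (R : Alg C) (n : ℕ) :
    R.snoc n ≫ R.X ◁ R.mulPow n ≫ R.mul = R.mulPow n ▷ R.X ≫ R.mul := by
  induction n with
  | zero =>
    change 𝟙 (R.X ⊗ R.X) ≫ R.X ◁ 𝟙 R.X ≫ R.mul = 𝟙 R.X ▷ R.X ≫ R.mul
    simp
  | succ n ih =>
    change ((α_ R.X (R.pow n) R.X).hom ≫ R.X ◁ R.snoc n) ≫
      R.X ◁ (R.X ◁ R.mulPow n ≫ R.mul) ≫ R.mul = (R.X ◁ R.mulPow n ≫ R.mul) ▷ R.X ≫ R.mul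
    rw [Category.assoc, ← MonoidalCategory.whiskerLeft_comp_assoc, ih,
      MonoidalCategory.whiskerLeft_comp_assoc, comp_whiskerRight_assoc, R.assoc]
    simp

lemma act_snoc (R : Alg C) (n : ℕ) :
    R.act n ▷ R.X ≫ R.snoc n =
      (α_ R.X (R.pow n) R.X).hom ≫ R.X ◁ R.snoc n ≫ R.freeAct (R.pow n) := by
  cases n with
  | zero =>
    change R.mul ▷ R.X ≫ 𝟙 _ = (α_ R.X R.X R.X).hom ≫ R.X ◁ 𝟙 (R.X ⊗ R.X) ≫ R.freeAct R.X
    simp [freeAct]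
  | succ n =>
    change R.freeAct (R.pow n) ▷ R.X ≫ (α_ R.X (R.pow n) R.X).hom ≫ R.X ◁ R.snoc n =
      (α_ R.X (R.X ⊗ R.pow n) R.X).hom ≫
        R.X ◁ ((α_ R.X (R.pow n) R.X).hom ≫ R.X ◁ R.snoc n) ≫ R.freeAct (R.X ⊗ R.pow n)
    simp only [MonoidalCategory.whiskerLeft_comp, Category.assoc, ← freeAct_natural]
    simp [freeAct]

variable {U S R : Alg C}

/-- Apply `s` to the product of the last two factors. -/
def lastSplit (u : U ⟶ S) (s : U.X ⟶ S.X ⊗ S.X) : ∀ n : ℕ, U.X ⊗ U.pow n ⟶ S.pow n ⊗ S.X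
  | 0 => U.mul ≫ s
  | n + 1 => (u.hom ⊗ₘ lastSplit u s n) ≫ (α_ S.X (S.pow n) S.X).inv

variable {u : U ⟶ S} {s : U.X ⟶ S.X ⊗ S.X}

/-- Linearity moves all factors but the last two out of `s`, into its left tensor factor. Thus on
products of `n + 2` elements the left factor of `s` is a product of `n + 1` elements. -/
lemma IsPartialSplitting.lastSplit_mulPow (h : IsPartialSplitting u s) (n : ℕ) :
    lastSplit u s n ≫ S.mulPow n ▷ S.X = U.X ◁ U.mulPow n ≫ U.mul ≫ s := by
  induction n with
  | zero =>
    change (U.mul ≫ s) ≫ 𝟙 S.X ▷ S.X = U.X ◁ 𝟙 U.X ≫ U.mul ≫ s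
    simp
  | succ n ih =>
    change ((u.hom ⊗ₘ lastSplit u s n) ≫ (α_ S.X (S.pow n) S.X).inv) ≫
      (S.X ◁ S.mulPow n ≫ S.mul) ▷ S.X = U.X ◁ (U.X ◁ U.mulPow n ≫ U.mul) ≫ U.mul ≫ s
    rw [MonoidalCategory.whiskerLeft_comp_assoc, h.linear, ← id_tensorHom (U.X),
      tensorHom_comp_tensorHom_assoc, Category.id_comp, ← ih, comp_whiskerRight, freeAct]
    have e : u.hom ⊗ₘ (lastSplit u s n ≫ S.mulPow n ▷ S.X) =
        (u.hom ⊗ₘ lastSplit u s n) ≫ S.X ◁ S.mulPow n ▷ S.X := by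
      rw [← id_tensorHom, tensorHom_comp_tensorHom, Category.comp_id]
    rw [e]
    simp

/-- The map `τ` is good only on products of `j + 1` factors. On products of `j + 2` factors the left
half of `s` consists of such products, by `lastSplit_mulPow`, so `τ` may be applied there. -/
lemma IsPowerSplitting.succ (h : IsPartialSplitting u s) {t : S ⟶ R} {j : ℕ} {τ : S.X ⟶ R.pow j}
    (hτ : IsPowerSplitting t j τ) :
    IsPowerSplitting (u ≫ t) (j + 1) (s ≫ (τ ⊗ₘ t.hom) ≫ R.snoc j) where
  mul := by
    change (U.X ◁ U.mulPow j ≫ U.mul) ≫ (s ≫ (τ ⊗ₘ t.hom) ≫ R.snoc j) ≫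
      R.X ◁ R.mulPow j ≫ R.mul = (U.X ◁ U.mulPow j ≫ U.mul) ≫ u.hom ≫ t.hom
    have e : S.mulPow j ▷ S.X ≫ (τ ⊗ₘ t.hom) ≫ R.mulPow j ▷ R.X =
        S.mulPow j ▷ S.X ≫ (t.hom ⊗ₘ t.hom) := by
      simp only [← tensorHom_id, tensorHom_comp_tensorHom, hτ.mul, Category.id_comp,
        Category.comp_id]
    simp only [Category.assoc, snoc_mulPow]
    rw [← reassoc_of% (h.lastSplit_mulPow j), reassoc_of% e, reassoc_of% (h.lastSplit_mulPow j),
      ← t.map_mul, reassoc_of% h.mul]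
  linear := by
    change U.X ◁ (U.X ◁ U.mulPow j ≫ U.mul) ≫ U.mul ≫ s ≫ (τ ⊗ₘ t.hom) ≫ R.snoc j =
      ((u.hom ≫ t.hom) ⊗ₘ ((U.X ◁ U.mulPow j ≫ U.mul) ≫ s ≫ (τ ⊗ₘ t.hom) ≫ R.snoc j)) ≫
        R.freeAct (R.pow j)
    have e1 : (u.hom ⊗ₘ (lastSplit u s j ≫ S.mulPow j ▷ S.X)) =
        (u.hom ⊗ₘ lastSplit u s j) ≫ S.X ◁ S.mulPow j ▷ S.X := by
      rw [← id_tensorHom, tensorHom_comp_tensorHom, Category.comp_id]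
    have e2 : S.X ◁ S.mulPow j ▷ S.X ≫ S.freeAct S.X ≫ (τ ⊗ₘ t.hom) =
        (t.hom ⊗ₘ ((S.mulPow j ≫ τ) ⊗ₘ t.hom)) ≫ (α_ _ _ _).inv ≫ R.act j ▷ R.X := by
      rw [associator_inv_naturality_assoc, ← tensorHom_id (R.act j), tensorHom_comp_tensorHom,
        ← hτ.linear, freeAct, MonoidalCategory.tensorHom_def]
      simp [MonoidalCategory.tensorHom_def]
    rw [MonoidalCategory.whiskerLeft_comp_assoc, reassoc_of% h.linear, ← id_tensorHom (U.X),
      tensorHom_comp_tensorHom_assoc, Category.id_comp, ← h.lastSplit_mulPow, e1,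
      Category.assoc, reassoc_of% e2, act_snoc, Iso.inv_hom_id_assoc]
    have e3 : (U.X ◁ U.mulPow j ≫ U.mul) ≫ s ≫ (τ ⊗ₘ t.hom) ≫ R.snoc j =
        lastSplit u s j ≫ ((S.mulPow j ≫ τ) ⊗ₘ t.hom) ≫ R.snoc j := by
      rw [Category.assoc, ← reassoc_of% (h.lastSplit_mulPow j), ← tensorHom_id,
        tensorHom_comp_tensorHom_assoc, Category.id_comp]
    rw [e3, ← id_tensorHom R.X]
    simp only [tensorHom_comp_tensorHom_assoc, Category.comp_id]

/-- A longer product is also a product of `j + 1` factors: group the last ones together. -/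
lemma IsPowerSplitting.mul_of_le [Preadditive C] {t : S ⟶ R} {j : ℕ} {τ : S.X ⟶ R.pow j}
    (hτ : IsPowerSplitting t j τ) {n : ℕ} (h : j ≤ n) :
    S.mulPow n ≫ τ ≫ R.mulPow j = S.mulPow n ≫ t.hom := by
  rw [← S.shrink_mulPow n j h, Category.assoc, hτ.mul, Category.assoc]

lemma IsPowerSplitting.linear_of_le [Preadditive C] {t : S ⟶ R} {j : ℕ} {τ : S.X ⟶ R.pow j}
    (hτ : IsPowerSplitting t j τ) {n : ℕ} (h : j ≤ n) :
    S.X ◁ S.mulPow n ≫ S.mul ≫ τ = (t.hom ⊗ₘ (S.mulPow n ≫ τ)) ≫ R.act j := by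
  rw [← S.shrink_mulPow n j h, MonoidalCategory.whiskerLeft_comp_assoc, hτ.linear,
    ← id_tensorHom, tensorHom_comp_tensorHom_assoc, Category.id_comp, Category.assoc]

/-- The isomorphism `R^{⊗ (j + k + 2)} ⟶ R^{⊗ (j + 1)} ⊗ R^{⊗ (k + 1)}`. -/
def splitPow (R : Alg C) (k : ℕ) : ∀ j : ℕ, R.pow (k + 1 + j) ⟶ R.pow j ⊗ R.pow k
  | 0 => 𝟙 (R.X ⊗ R.pow k)
  | j + 1 => R.X ◁ splitPow R k j ≫ (α_ R.X (R.pow j) (R.pow k)).inv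

lemma act_splitPow (R : Alg C) (k j : ℕ) :
    R.act (k + 1 + j) ≫ R.splitPow k j =
      R.X ◁ R.splitPow k j ≫ (α_ R.X (R.pow j) (R.pow k)).inv ≫ R.act j ▷ R.pow k := by
  cases j with
  | zero =>
    change R.freeAct (R.pow k) ≫ 𝟙 (R.X ⊗ R.pow k) =
      R.X ◁ 𝟙 (R.X ⊗ R.pow k) ≫ (α_ R.X R.X (R.pow k)).inv ≫ R.mul ▷ R.pow k
    simp [freeAct]
  | succ j =>
    change R.freeAct (R.pow (k + 1 + j)) ≫ R.X ◁ R.splitPow k j ≫ (α_ R.X (R.pow j) (R.pow k)).inv =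
      R.X ◁ (R.X ◁ R.splitPow k j ≫ (α_ R.X (R.pow j) (R.pow k)).inv) ≫
        (α_ R.X (R.X ⊗ R.pow j) (R.pow k)).inv ≫ R.freeAct (R.pow j) ▷ R.pow k
    rw [reassoc_of% R.freeAct_natural (R.splitPow k j)]
    simp [freeAct]

lemma splitPow_mulPow (R : Alg C) (k j : ℕ) :
    R.splitPow k j ≫ (R.mulPow j ⊗ₘ R.mulPow k) ≫ R.mul = R.mulPow (k + 1 + j) := by
  induction j with
  | zero =>
    change 𝟙 (R.X ⊗ R.pow k) ≫ (𝟙 R.X ⊗ₘ R.mulPow k) ≫ R.mul = R.X ◁ R.mulPow k ≫ R.mul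
    simp
  | succ j ih =>
    change (R.X ◁ R.splitPow k j ≫ (α_ R.X (R.pow j) (R.pow k)).inv) ≫
      ((R.X ◁ R.mulPow j ≫ R.mul) ⊗ₘ R.mulPow k) ≫ R.mul = R.X ◁ R.mulPow (k + 1 + j) ≫ R.mul
    rw [← ih]
    simp only [MonoidalCategory.whiskerLeft_comp, Category.assoc]
    rw [← R.assoc_inv]
    simp [MonoidalCategory.tensorHom_def']

end PowerSplitting

/-! ### From tensor powers to powers of the algebra. -/

section Powers

variable {C : Type u} [Category.{v} C] [MonoidalCategory C] [Preadditive C]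
  [HasKernels C] [HasCokernels C]

variable [MonoidalPreadditive C]
  [∀ (X : C) ⦃Y Z : C⦄ (f : Y ⟶ Z), PreservesColimit (parallelPair f 0) (tensorLeft X)]

/-- The composite of `τ` with the projection to `R^{j+1}` is defined on all of `S`, so it extends
the transition map from `S^{n+1}` to `S`. This is what makes `K^∞ → K` a cofibration. -/
lemma IsPowerSplitting.powerι_powerπ {S R : Alg C} {t : S ⟶ R} {j : ℕ} {τ : S.X ⟶ R.pow j}
    (hτ : IsPowerSplitting t j τ) {n : ℕ} (h : j ≤ n) :
    S.powerι n ≫ τ ≫ R.powerπ j = powerMapHom t h := by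
  rw [← cancel_epi (S.powerπ n), reassoc_of% S.powerπ_ι n,
    powerπ_mapHom t h (S.mulPow n ≫ τ) (by rw [Category.assoc, hτ.mul_of_le h]), Category.assoc]

/-- A left linear splitting of the multiplication, along a homomorphism `t : S ⟶ R`. -/
structure IsLinearSplitting {S R : Alg C} (t : S ⟶ R) (σ : S.X ⟶ R.X ⊗ R.X) : Prop where
  mul : σ ≫ R.mul = t.hom
  linear : S.mul ≫ σ = (t.hom ⊗ₘ σ) ≫ R.freeAct R.X

/-- A tensor power with `2(j + 1)` factors is cut into two halves, each of which projects to
`R^{j+1}`. On `S^{n+1}` every element is a product of enough factors, so the lifting property and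
linearity of `τ`, known only on products, hold throughout. -/
theorem IsPowerSplitting.isLinearSplitting {S R : Alg C} {t : S ⟶ R} {j : ℕ}
    {τ : S.X ⟶ R.pow (j + 1 + j)} (hτ : IsPowerSplitting t (j + 1 + j) τ) {n : ℕ}
    (h : j + 1 + j ≤ n) (h' : j ≤ n) :
    IsLinearSplitting (powerMap t h')
      (S.powerι n ≫ τ ≫ R.splitPow j j ≫ (R.powerπ j ⊗ₘ R.powerπ j)) where
  mul := by
    change (S.powerι n ≫ τ ≫ R.splitPow j j ≫ (R.powerπ j ⊗ₘ R.powerπ j)) ≫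
      R.powerι j ▷ R.powerObj j ≫ R.powerAct j = powerMapHom t h'
    have e : (R.powerπ j ⊗ₘ R.powerπ j) ≫ R.powerι j ▷ R.powerObj j ≫ R.powerAct j =
        R.mulPow j ▷ R.pow j ≫ R.act j ≫ R.powerπ j := by
      rw [← whiskerLeft_powerπ_act, ← tensorHom_id, ← tensorHom_id, ← id_tensorHom,
        tensorHom_comp_tensorHom_assoc, tensorHom_comp_tensorHom_assoc, powerπ_ι]
      simp
    rw [← cancel_epi (S.powerπ n)]
    simp only [Category.assoc]
    -- The map `R^{j+1} → R` is not known to be mono, so the two sides are compared through lifts to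
    -- the tensor power: lifts with the same product have the same class in the coimage.
    rw [e, reassoc_of% S.powerπ_ι n,
      powerπ_mapHom t h' (S.mulPow n ≫ τ ≫ R.splitPow j j ≫ R.mulPow j ▷ R.pow j ≫ R.act j)]
    · simp only [Category.assoc]
    · simp only [Category.assoc]
      rw [act_mulPow, ← hτ.mul_of_le h, ← splitPow_mulPow, tensorHom_def_assoc]
  linear := by
    change (S.powerι n ▷ S.powerObj n ≫ S.powerAct n) ≫
        S.powerι n ≫ τ ≫ R.splitPow j j ≫ (R.powerπ j ⊗ₘ R.powerπ j) =
      (powerMapHom t h' ⊗ₘ (S.powerι n ≫ τ ≫ R.splitPow j j ≫ (R.powerπ j ⊗ₘ R.powerπ j))) ≫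
        (α_ _ _ _).inv ≫ (R.powerι j ▷ R.powerObj j ≫ R.powerAct j) ▷ R.powerObj j
    -- Since the tensor product preserves cokernels, linearity in the second variable may be tested
    -- on `S.pow n`, where it is a genuine product.
    have := S.epi_whiskerLeft_powerπ n (S.powerObj n)
    rw [← cancel_epi (S.powerObj n ◁ S.powerπ n)]
    have e1 : S.powerObj n ◁ S.powerπ n ≫ S.powerι n ▷ S.powerObj n ≫ S.powerAct n ≫
        S.powerι n = S.powerι n ▷ S.pow n ≫ S.X ◁ S.mulPow n ≫ S.mul := by
      rw [powerAct_ι, whisker_exchange_assoc,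
        ← MonoidalCategory.whiskerLeft_comp_assoc, powerπ_ι]
    have e3 : S.powerι n ▷ S.pow n ≫ (t.hom ⊗ₘ (S.mulPow n ≫ τ)) =
        powerMapHom t h' ▷ S.pow n ≫ R.powerι j ▷ S.pow n ≫ R.X ◁ (S.mulPow n ≫ τ) := by
      rw [MonoidalCategory.tensorHom_def, ← comp_whiskerRight_assoc, ← comp_whiskerRight_assoc, powerMapHom_ι]
    have e4 : S.powerObj n ◁ S.powerπ n ≫ (powerMapHom t h' ⊗ₘ
        (S.powerι n ≫ τ ≫ R.splitPow j j ≫ (R.powerπ j ⊗ₘ R.powerπ j))) =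
        powerMapHom t h' ▷ S.pow n ≫ R.powerObj j ◁ (S.mulPow n ≫ τ) ≫
          R.powerObj j ◁ (R.splitPow j j ≫ (R.powerπ j ⊗ₘ R.powerπ j)) := by
      rw [MonoidalCategory.tensorHom_def', ← MonoidalCategory.whiskerLeft_comp_assoc, whisker_exchange,
        reassoc_of% S.powerπ_ι n, ← MonoidalCategory.whiskerLeft_comp, Category.assoc]
    have e5 : R.powerι j ▷ R.pow (j + 1 + j) ≫ R.act (j + 1 + j) ≫ R.splitPow j j ≫
        (R.powerπ j ⊗ₘ R.powerπ j) =
        R.powerObj j ◁ (R.splitPow j j ≫ (R.powerπ j ⊗ₘ R.powerπ j)) ≫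
        (α_ _ _ _).inv ≫ (R.powerι j ▷ R.powerObj j ≫ R.powerAct j) ▷ R.powerObj j := by
      rw [reassoc_of% R.act_splitPow j j, ← whisker_exchange_assoc,
        MonoidalCategory.tensorHom_def, ← comp_whiskerRight_assoc, ← whiskerLeft_powerπ_act,
        comp_whiskerRight_assoc, associator_inv_naturality_left_assoc,
        ← comp_whiskerRight_assoc (R.powerι j ▷ R.pow j), ← whisker_exchange,
        comp_whiskerRight_assoc, ← whisker_exchange, ← whisker_exchange_assoc]
      simp
    rw [Category.assoc, reassoc_of% e1, reassoc_of% (hτ.linear_of_le h), reassoc_of% e3, reassoc_of% e4,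
      ← whisker_exchange_assoc, e5]

end Powers
end Alg

/-! ### Splittings for `K^∞`, and extension of maps from `K^∞` to `K`. -/

section Levels

variable {C : Type u} [Category.{v} C] [Preadditive C] [MonoidalCategory C]

lemma Alg.IsPowerSplitting.precomp {U S R : Alg C} (v : U ⟶ S) {t : S ⟶ R} {j : ℕ}
    {τ : S.X ⟶ R.pow j} (hτ : IsPowerSplitting t j τ) :
    IsPowerSplitting (v ≫ t) j (v.hom ≫ τ) where
  mul := by
    rw [Category.assoc, ← reassoc_of% powHom_mulPow, hτ.mul, reassoc_of% powHom_mulPow]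
    rfl
  linear := by
    have e : U.X ◁ U.mulPow j ≫ (v.hom ⊗ₘ v.hom) = (v.hom ⊗ₘ powHom v j) ≫ S.X ◁ S.mulPow j := by
      rw [← id_tensorHom, ← id_tensorHom, tensorHom_comp_tensorHom, tensorHom_comp_tensorHom,
        Category.id_comp, Category.comp_id, powHom_mulPow]
    rw [reassoc_of% v.map_mul, reassoc_of% e, hτ.linear, tensorHom_comp_tensorHom_assoc,
      reassoc_of% powHom_mulPow]
    rfl

theorem ProAlg.exists_isPowerSplitting {K : ProAlg C}
    (hK : ∀ n : ℕ+, ∃ (m : ℕ+) (e : op m ⟶ op n) (s : _), Alg.IsPartialSplitting (K.map e) s)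
    (j : ℕ) (n p : ℕ+) :
    ∃ (m : ℕ+) (_ : p ≤ m) (e : op m ⟶ op n) (τ : _), Alg.IsPowerSplitting (K.map e) j τ := by
  have key : ∀ j n, ∃ (m : ℕ+) (e : op m ⟶ op n) (τ : _),
      Alg.IsPowerSplitting (K.map e) j τ := by
    intro j
    induction j with
    | zero => exact fun n => ⟨n, 𝟙 _, _, Alg.isPowerSplitting_zero _⟩
    | succ j ih =>
      intro n
      obtain ⟨q, e, τ, hτ⟩ := ih n
      obtain ⟨m, e', s, hs⟩ := hK q
      refine ⟨m, e' ≫ e, s ≫ (τ ⊗ₘ (K.map e).hom) ≫ (K.obj (op n)).snoc j, ?_⟩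
      rw [K.map_comp]
      exact hτ.succ hs
  obtain ⟨m, e, τ, hτ⟩ := key j n
  -- Passing to a deeper level preserves power splittings, so the source index may be taken as large
  -- as desired.
  let d : op (max m p) ⟶ op m := (homOfLE (le_max_left m p)).op
  refine ⟨max m p, le_max_right m p, d ≫ e, (K.map d).hom ≫ τ, ?_⟩
  rw [K.map_comp]
  exact hτ.precomp (K.map d)

variable [HasKernels C] [HasCokernels C] [MonoidalPreadditive C]
  [∀ (X : C) ⦃Y Z : C⦄ (f : Y ⟶ Z), PreservesColimit (parallelPair f 0) (tensorLeft X)]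

theorem ProAlg.exists_isLinearSplitting {K : ProAlg C}
    (hK : ∀ n : ℕ+, ∃ (m : ℕ+) (e : op m ⟶ op n) (s : _), Alg.IsPartialSplitting (K.map e) s)
    (n : ℕ+) :
    ∃ (m : ℕ+) (e : op m ⟶ op n) (σ : _), Alg.IsLinearSplitting (K.infPower.map e) σ := by
  -- Exponents are shifted by one: `pow` of `n.natPred + 1 + n.natPred` has `2n` factors. The bound
  -- `m ≥ 2n` makes `K_m^m` consist of products of at least `2n` elements.
  obtain ⟨m, hm, e, τ, hτ⟩ := exists_isPowerSplitting hK (n.natPred + 1 + n.natPred) n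
    (Nat.succPNat (n.natPred + 1 + n.natPred))
  have h : n.natPred + 1 + n.natPred ≤ m.natPred := by
    have := PNat.natPred_le_natPred.2 hm
    simpa using this
  exact ⟨m, e, _, hτ.isLinearSplitting h _⟩

theorem ProAlg.exists_infPowerIncl_comp {K : ProAlg C}
    (hK : ∀ n : ℕ+, ∃ (m : ℕ+) (e : op m ⟶ op n) (s : _), Alg.IsPartialSplitting (K.map e) s)
    {c : C} (g : K.infPower.toAlg.X ⟶ (constPro C).obj c) :
    ∃ f : K.toAlg.X ⟶ (constPro C).obj c, ProAlg.toProHom K.infPowerIncl ≫ f = g := by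
  obtain ⟨n, g, rfl⟩ := toConst_surjective g
  -- Here `n` factors suffice, and `m ≥ n` is contained in the existence of `e`; hence the trivial
  -- bound `1`.
  obtain ⟨m, -, e, τ, hτ⟩ := exists_isPowerSplitting hK n.natPred n 1
  refine ⟨toConst (ColimHom.mk m (τ ≫ (K.obj (op n)).powerπ n.natPred ≫ g)), ?_⟩
  refine constPro_hom_ext ((IsRep.toPro_map _ m).comp (isRep_toConst m m _))
    (((isRep_toConst m n g).precomp_map e).congr ?_)
  have h := hτ.powerι_powerπ (PNat.natPred_le_natPred.2 (leOfHom e.unop))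
  exact ((congrArg (fun k => k ≫ g) h).symm.trans (Category.assoc _ _ _)).trans
    (congrArg (fun k => (K.obj (op m)).powerι m.natPred ≫ k) (Category.assoc _ _ _))

end Levels

/-! ### The contracting homotopy of the bar complex. -/

section Homotopy

variable {C : Type u} [Category.{v} C] [Preadditive C] [MonoidalCategory C]
  [MonoidalPreadditive C]

lemma tensorHom_sub {W X Y Z : C} (f : W ⟶ X) (g h : Y ⟶ Z) :
    f ⊗ₘ (g - h) = f ⊗ₘ g - f ⊗ₘ h := by
  rw [eq_sub_iff_add_eq, ← MonoidalPreadditive.tensor_add, sub_add_cancel]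

lemma tensorHom_neg {W X Y Z : C} (f : W ⟶ X) (g : Y ⟶ Z) : f ⊗ₘ (-g) = -(f ⊗ₘ g) := by
  rw [eq_neg_iff_add_eq_zero, ← MonoidalPreadditive.tensor_add, neg_add_cancel,
    MonoidalPreadditive.tensor_zero]

namespace Alg

lemma tensorHom_freeAct {S R : Alg C} (t : S ⟶ R) {X Y : C} (f : X ⟶ Y) :
    (t.hom ⊗ₘ (t.hom ⊗ₘ f)) ≫ R.freeAct Y = S.freeAct X ≫ (t.hom ⊗ₘ f) := by
  rw [freeAct, freeAct, Category.assoc, associator_inv_naturality_assoc, ← tensorHom_id,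
    ← tensorHom_id, tensorHom_comp_tensorHom, tensorHom_comp_tensorHom, ← t.map_mul]
  simp

lemma powHom_barD {S R : Alg C} (t : S ⟶ R) (n : ℕ) :
    (t.hom ⊗ₘ powHom t n) ≫ R.barD n = S.barD n ≫ powHom t n := by
  induction n with
  | zero => exact t.map_mul.symm
  | succ n ih =>
    change (t.hom ⊗ₘ (t.hom ⊗ₘ powHom t n)) ≫ (R.freeAct (R.pow n) - R.X ◁ R.barD n) =
      (S.freeAct (S.pow n) - S.X ◁ S.barD n) ≫ (t.hom ⊗ₘ powHom t n)
    rw [Preadditive.comp_sub, Preadditive.sub_comp, tensorHom_freeAct, ← id_tensorHom,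
      ← id_tensorHom, tensorHom_comp_tensorHom, tensorHom_comp_tensorHom, ih, Category.id_comp,
      Category.comp_id]

/-- The contracting homotopy `a₀ ⊗ ⋯ ⊗ aₙ ↦ ± a₀ ⊗ ⋯ ⊗ σ(aₙ)` of the bar complex. -/
def barHomotopy {S R : Alg C} (t : S ⟶ R) (σ : S.X ⟶ R.X ⊗ R.X) :
    ∀ n : ℕ, S.pow n ⟶ R.X ⊗ R.pow n
  | 0 => σ
  | n + 1 => (-(t.hom ⊗ₘ barHomotopy t σ n) : S.X ⊗ S.pow n ⟶ R.X ⊗ (R.X ⊗ R.pow n))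

/-- This is the homotopy identity `b' h + h b' = t` in positive degrees, with the definition of `h`
in the next degree unfolded. Linearity of `σ` enters only in the base case, where it cancels the
term multiplying into the first factor. In the inductive step that term is disjoint from the last
factor and cancels by the alternating sign, leaving `t` tensored with the previous identity. -/
lemma IsLinearSplitting.barD_barHomotopy {S R : Alg C} {t : S ⟶ R} {σ : S.X ⟶ R.X ⊗ R.X}
    (h : IsLinearSplitting t σ) (n : ℕ) :
    S.barD n ≫ barHomotopy t σ n - (t.hom ⊗ₘ barHomotopy t σ n) ≫
      (R.freeAct (R.pow n) - R.X ◁ R.barD n) = t.hom ⊗ₘ powHom t n := by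
  induction n with
  | zero =>
    change S.mul ≫ σ - (t.hom ⊗ₘ σ) ≫ (R.freeAct R.X - R.X ◁ R.mul) = t.hom ⊗ₘ t.hom
    rw [Preadditive.comp_sub, h.linear, sub_sub_cancel, ← id_tensorHom, tensorHom_comp_tensorHom,
      h.mul, Category.comp_id]
  | succ n ih =>
    change (S.freeAct (S.pow n) - S.X ◁ S.barD n) ≫ (-(t.hom ⊗ₘ barHomotopy t σ n)) -
      (t.hom ⊗ₘ (-(t.hom ⊗ₘ barHomotopy t σ n))) ≫
        (R.freeAct (R.X ⊗ R.pow n) - R.X ◁ (R.freeAct (R.pow n) - R.X ◁ R.barD n)) =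
      t.hom ⊗ₘ (t.hom ⊗ₘ powHom t n)
    rw [tensorHom_neg, Preadditive.comp_neg, Preadditive.sub_comp, Preadditive.neg_comp,
      Preadditive.comp_sub, tensorHom_freeAct, ← ih, tensorHom_sub, ← id_tensorHom S.X,
      ← id_tensorHom R.X, tensorHom_comp_tensorHom, tensorHom_comp_tensorHom, Category.id_comp,
      Category.comp_id]
    abel

end Alg

end Homotopy

/-! ### Exactness of the bar complex against constant pro-objects. -/

section BarLevels

variable {C : Type u} [Category.{v} C] [Preadditive C] [MonoidalCategory C]

namespace IsRep

lemma sub {X Y : ProObj C} {f f' : X ⟶ Y} {n m : ℕ+}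
    {g g' : X.tower.obj (op m) ⟶ Y.tower.obj (op n)} (h : IsRep f n m g) (h' : IsRep f' n m g') :
    IsRep (f - f') n m (g - g') := by
  have e : ColimHom.mk m (g - g') + ColimHom.mk m g' = ColimHom.mk (X := X.tower) m g := by
    rw [← ColimHom.mk_add, sub_add_cancel]
  change Subtype.val (show proHom X.tower Y.tower from f) n -
    Subtype.val (show proHom X.tower Y.tower from f') n = _
  rw [show Subtype.val (show proHom X.tower Y.tower from f) n = _ from h,
    show Subtype.val (show proHom X.tower Y.tower from f') n = _ from h', ← e,
    add_sub_cancel_right]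

lemma zero (X Y : ProObj C) (n m : ℕ+) : IsRep (0 : X ⟶ Y) n m 0 := by
  have e : ColimHom.mk m (0 : X.tower.obj (op m) ⟶ Y.tower.obj (op n)) = 0 :=
    left_eq_add.1 ((congrArg (ColimHom.mk m) (add_zero _).symm).trans (ColimHom.mk_add m 0 0))
  exact e.symm

end IsRep

section

variable [MonoidalPreadditive C] {S R : Alg C} {t : S ⟶ R} {σ : S.X ⟶ R.X ⊗ R.X}
  (h : Alg.IsLinearSplitting t σ) {U V c : C}

include h

/-- The map `t` factors through the multiplication by way of `σ`: this is exactness in degree zero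
along `t`. -/
lemma Alg.IsLinearSplitting.tensorHom_comp_eq_zero (v : U ⟶ V) {f : V ⊗ R.X ⟶ c}
    (hf : V ◁ R.mul ≫ f = 0) : (v ⊗ₘ t.hom) ≫ f = 0 := by
  have h' : v ⊗ₘ t.hom = (v ⊗ₘ σ) ≫ V ◁ R.mul := by
    rw [← id_tensorHom, tensorHom_comp_tensorHom, h.mul, Category.comp_id]
  rw [h', Category.assoc, hf, comp_zero]

/-- In the homotopy identity, the term passing through the boundary of the target is killed by the
cocycle `f`. So the restriction of `f` along `t` is the coboundary of `h` followed by `f`. -/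
lemma Alg.IsLinearSplitting.whiskerLeft_barD_comp (n : ℕ) (v : U ⟶ V)
    {f : V ⊗ (R.X ⊗ R.pow n) ⟶ c}
    (hf : V ◁ (R.freeAct (R.pow n) - R.X ◁ R.barD n) ≫ f = 0) :
    U ◁ S.barD n ≫ (v ⊗ₘ barHomotopy t σ n) ≫ f = (v ⊗ₘ (t.hom ⊗ₘ powHom t n)) ≫ f := by
  have e : ∀ (u : S.X ⊗ S.pow n ⟶ R.X ⊗ (R.X ⊗ R.pow n))
      (w : R.X ⊗ (R.X ⊗ R.pow n) ⟶ R.X ⊗ R.pow n), v ⊗ₘ (u ≫ w) = (v ⊗ₘ u) ≫ V ◁ w := by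
    intro u w
    rw [← id_tensorHom, tensorHom_comp_tensorHom, Category.comp_id]
  rw [← h.barD_barHomotopy n, tensorHom_sub, Preadditive.sub_comp, ← id_tensorHom,
    tensorHom_comp_tensorHom_assoc, Category.id_comp, e, Category.assoc, hf, comp_zero, sub_zero]

end

namespace ProAlg

variable (B : ProAlg C)

/-- The `m`-th level of a tensor power of a pro-algebra is the tensor power of its `m`-th level. -/
def powIso (m : ℕ+) : ∀ n : ℕ, (B.toAlg.pow n).tower.obj (op m) ≅ (B.obj (op m)).pow n
  | 0 => Iso.refl (B.obj (op m)).X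
  | n + 1 => whiskerLeftIso (B.obj (op m)).X (powIso m n)

lemma powIso_naturality {m m' : ℕ+} (e : op m' ⟶ op m) (n : ℕ) :
    (B.toAlg.pow n).tower.map e ≫ (B.powIso m n).hom =
      (B.powIso m' n).hom ≫ Alg.powHom (B.map e) n := by
  induction n with
  | zero => exact (Category.comp_id _).trans (Category.id_comp _).symm
  | succ n ih =>
    change ((B.map e).hom ⊗ₘ (B.toAlg.pow n).tower.map e) ≫
      (B.obj (op m)).X ◁ (B.powIso m n).hom =
      (B.obj (op m')).X ◁ (B.powIso m' n).hom ≫ ((B.map e).hom ⊗ₘ Alg.powHom (B.map e) n)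
    rw [← id_tensorHom, ← id_tensorHom, tensorHom_comp_tensorHom, tensorHom_comp_tensorHom, ih,
      Category.comp_id, Category.id_comp]

variable [MonoidalPreadditive C]

lemma isRep_barD (m : ℕ+) (n : ℕ) :
    IsRep (B.toAlg.barD n) m m ((B.obj (op m)).X ◁ (B.powIso m n).hom ≫
      (B.obj (op m)).barD n ≫ (B.powIso m n).inv) := by
  have repB : IsRep B.toAlg.mul m m (B.obj (op m)).mul := IsRep.toPro_map _ m
  induction n with
  | zero =>
    refine repB.congr ?_
    change (B.obj (op m)).mul = (B.obj (op m)).X ◁ 𝟙 (B.obj (op m)).X ≫ (B.obj (op m)).mul ≫ 𝟙 _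
    simp
  | succ n ih =>
    refine (((IsRep.toPro_map (α_ B.toAlg.X.tower B.toAlg.X.tower (B.toAlg.pow n).tower).inv
      m).comp (repB.whiskerRight_self (B.toAlg.pow n))).sub
        (ih.whiskerLeft_self B.toAlg.X)).congr ?_
    change (α_ (B.obj (op m)).X (B.obj (op m)).X ((B.toAlg.pow n).tower.obj (op m))).inv ≫
      (B.obj (op m)).mul ▷ (B.toAlg.pow n).tower.obj (op m) -
      (B.obj (op m)).X ◁ ((B.obj (op m)).X ◁ (B.powIso m n).hom ≫
      (B.obj (op m)).barD n ≫ (B.powIso m n).inv) =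
      (B.obj (op m)).X ◁ (B.obj (op m)).X ◁ (B.powIso m n).hom ≫
      ((B.obj (op m)).freeAct ((B.obj (op m)).pow n) -
        (B.obj (op m)).X ◁ (B.obj (op m)).barD n) ≫
        (B.obj (op m)).X ◁ (B.powIso m n).inv
    rw [Preadditive.sub_comp, Preadditive.comp_sub, Alg.freeAct_natural]
    simp only [← MonoidalCategory.whiskerLeft_comp, ← MonoidalCategory.whiskerLeft_comp_assoc]
    simp [Alg.freeAct]

variable (V : ProObj C) {c : C}

/-- The map `V ⊗ B^{⊗ (n + 1)} ⟶ c` of pro-objects given by a map on the `m`-th level. -/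
def barClass (m : ℕ+) (n : ℕ) (f : V.tower.obj (op m) ⊗ (B.obj (op m)).pow n ⟶ c) :
    V ⊗ B.toAlg.pow n ⟶ (constPro C).obj c :=
  toConst (X := V ⊗ B.toAlg.pow n)
    (ColimHom.mk m (V.tower.obj (op m) ◁ (B.powIso m n).hom ≫ f :
      V.tower.obj (op m) ⊗ (B.toAlg.pow n).tower.obj (op m) ⟶ c))

lemma isRep_barClass (m : ℕ+) (n : ℕ) (f : V.tower.obj (op m) ⊗ (B.obj (op m)).pow n ⟶ c) :
    IsRep (B.barClass V m n f) m m (V.tower.obj (op m) ◁ (B.powIso m n).hom ≫ f :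
      V.tower.obj (op m) ⊗ (B.toAlg.pow n).tower.obj (op m) ⟶ c) := rfl

lemma barClass_surjective {n : ℕ} (x : V ⊗ B.toAlg.pow n ⟶ (constPro C).obj c) :
    ∃ m f, x = B.barClass V m n f := by
  obtain ⟨m, g, rfl⟩ := toConst_surjective x
  have h : ∀ g : V.tower.obj (op m) ⊗ (B.toAlg.pow n).tower.obj (op m) ⟶ c,
      g = V.tower.obj (op m) ◁ (B.powIso m n).hom ≫ V.tower.obj (op m) ◁ (B.powIso m n).inv ≫ g :=
    fun g => by simp
  exact ⟨m, V.tower.obj (op m) ◁ (B.powIso m n).inv ≫ g,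
    congrArg (fun k => toConst (X := V ⊗ B.toAlg.pow n) (ColimHom.mk m k)) (h g)⟩

lemma tensorHom_map_powIso {m m' : ℕ+} (e : op m' ⟶ op m) (n : ℕ)
    (f : V.tower.obj (op m) ⊗ (B.obj (op m)).pow n ⟶ c) :
    (V.tower.map e ⊗ₘ (B.toAlg.pow n).tower.map e) ≫ V.tower.obj (op m) ◁ (B.powIso m n).hom ≫ f =
      V.tower.obj (op m') ◁ (B.powIso m' n).hom ≫
        (V.tower.map e ⊗ₘ Alg.powHom (B.map e) n) ≫ f := by
  rw [← id_tensorHom, ← id_tensorHom, tensorHom_comp_tensorHom_assoc,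
    tensorHom_comp_tensorHom_assoc, powIso_naturality, Category.id_comp, Category.comp_id]

lemma barClass_map {m m' : ℕ+} (e : op m' ⟶ op m) (n : ℕ)
    (f : V.tower.obj (op m) ⊗ (B.obj (op m)).pow n ⟶ c) :
    B.barClass V m' n ((V.tower.map e ⊗ₘ Alg.powHom (B.map e) n) ≫ f) = B.barClass V m n f :=
  constPro_hom_ext (n := m') (B.isRep_barClass V m' n _)
    (((isRep_toConst m' m _).precomp_map e).congr (B.tensorHom_map_powIso V e n f))

lemma eventually_eq_zero {m : ℕ+} {n : ℕ}
    {f : V.tower.obj (op m) ⊗ (B.obj (op m)).pow n ⟶ c} (h : B.barClass V m n f = 0) :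
    ∃ (m' : ℕ+) (e : op m' ⟶ op m), (V.tower.map e ⊗ₘ Alg.powHom (B.map e) n) ≫ f = 0 := by
  obtain ⟨k, e, e', hk⟩ := IsRep.eventually_eq (B.isRep_barClass V m n f)
    (h.symm ▸ IsRep.zero _ _ m m)
  refine ⟨k, e, ?_⟩
  rw [← cancel_epi (V.tower.obj (op k) ◁ (B.powIso k n).hom), comp_zero]
  exact ((B.tensorHom_map_powIso V e n f).symm.trans hk).trans comp_zero

lemma whiskerLeft_barD_barClass (m : ℕ+) (n : ℕ)
    (f : V.tower.obj (op m) ⊗ (B.obj (op m)).pow n ⟶ c) :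
    V ◁ B.toAlg.barD n ≫ B.barClass V m n f =
      B.barClass V m (n + 1) (V.tower.obj (op m) ◁ (B.obj (op m)).barD n ≫ f) := by
  refine constPro_hom_ext (((B.isRep_barD m n).whiskerLeft_self V).comp
    (B.isRep_barClass V m n f)) ((B.isRep_barClass V m (n + 1) _).congr ?_)
  change V.tower.obj (op m) ◁ (B.obj (op m)).X ◁ (B.powIso m n).hom ≫
    V.tower.obj (op m) ◁ (B.obj (op m)).barD n ≫ f =
    V.tower.obj (op m) ◁ ((B.obj (op m)).X ◁ (B.powIso m n).hom ≫
      (B.obj (op m)).barD n ≫ (B.powIso m n).inv) ≫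
      V.tower.obj (op m) ◁ (B.powIso m n).hom ≫ f
  simp only [← MonoidalCategory.whiskerLeft_comp_assoc, Category.assoc, Iso.inv_hom_id,
    Category.comp_id]

/-- The cocycle condition on a class holds strictly for its representative after restriction to a
deeper level, because `b'` commutes with transition maps. -/
lemma exists_barClass_cocycle {n : ℕ} (x : V ⊗ B.toAlg.pow n ⟶ (constPro C).obj c)
    (hx : V ◁ B.toAlg.barD n ≫ x = 0) :
    ∃ m f, x = B.barClass V m n f ∧ V.tower.obj (op m) ◁ (B.obj (op m)).barD n ≫ f = 0 := by
  obtain ⟨m, f, rfl⟩ := B.barClass_surjective V x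
  rw [whiskerLeft_barD_barClass] at hx
  obtain ⟨m', e, h⟩ := B.eventually_eq_zero V hx
  refine ⟨m', _, (B.barClass_map V e n f).symm, ?_⟩
  replace h : (V.tower.map e ⊗ₘ ((B.map e).hom ⊗ₘ Alg.powHom (B.map e) n)) ≫
    V.tower.obj (op m) ◁ (B.obj (op m)).barD n ≫ f = 0 := h
  rw [← id_tensorHom, tensorHom_comp_tensorHom_assoc, Alg.powHom_barD] at h
  rw [← id_tensorHom, tensorHom_comp_tensorHom_assoc, Category.id_comp]
  rwa [Category.comp_id] at h

variable {B}
  (hB : ∀ n : ℕ+, ∃ (m : ℕ+) (e : op m ⟶ op n) (σ : _), Alg.IsLinearSplitting (B.map e) σ)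

include hB

lemma eq_zero_of_barD_zero (x : V ⊗ B.toAlg.pow 0 ⟶ (constPro C).obj c)
    (hx : V ◁ B.toAlg.barD 0 ≫ x = 0) : x = 0 := by
  obtain ⟨m, f, rfl, hf⟩ := B.exists_barClass_cocycle V x hx
  obtain ⟨k, e, σ, hσ⟩ := hB m
  have h : (V.tower.map e ⊗ₘ Alg.powHom (B.map e) 0) ≫ f = 0 := hσ.tensorHom_comp_eq_zero _ hf
  rw [← B.barClass_map V e, h]
  exact constPro_hom_ext (n := k) (B.isRep_barClass V k 0 _)
    ((IsRep.zero _ _ k k).congr comp_zero.symm)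

lemma exists_barD_comp_eq {n : ℕ} (x : V ⊗ B.toAlg.pow (n + 1) ⟶ (constPro C).obj c)
    (hx : V ◁ B.toAlg.barD (n + 1) ≫ x = 0) :
    ∃ y : V ⊗ B.toAlg.pow n ⟶ (constPro C).obj c, V ◁ B.toAlg.barD n ≫ y = x := by
  obtain ⟨m, f, rfl, hf⟩ := B.exists_barClass_cocycle V x hx
  obtain ⟨k, e, σ, hσ⟩ := hB m
  refine ⟨B.barClass V k n ((V.tower.map e ⊗ₘ Alg.barHomotopy (B.map e) σ n) ≫ f), ?_⟩
  rw [whiskerLeft_barD_barClass, ← B.barClass_map V e]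
  exact congrArg (B.barClass V k (n + 1)) (hσ.whiskerLeft_barD_comp n (V.tower.map e) hf)

end ProAlg
end BarLevels

/-! ### Relatively injective pro-objects as retracts of products of constant ones. -/

section ProductTower

variable {C : Type u} [Category.{v} C] [Preadditive C]

lemma ColimHom.push_sum {ι : Type*} (s : Finset ι) {X : Tower C} {c d : C} (g : ι → (c ⟶ d))
    (x : ColimHom X c) : ColimHom.push X (∑ i ∈ s, g i) x = ∑ i ∈ s, ColimHom.push X (g i) x :=
  map_sum (AddMonoidHom.mk' (fun g => ColimHom.push X g x) (fun g h => ColimHom.push_add g h x)) g s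

lemma ColimHom.push_zero {X : Tower C} {c d : C} (x : ColimHom X c) :
    ColimHom.push X (0 : c ⟶ d) x = 0 := by
  simpa using ColimHom.push_sum (∅ : Finset ℕ) (fun _ => (0 : c ⟶ d)) x

variable [HasFiniteBiproducts C]

/-- Being additive in the target, `colim hom(X_m, -)` preserves finite biproducts. Therefore a
pro-map to `prodTower F` amounts to an arbitrary family of classes, one for each `k`. -/
lemma ColimHom.biproduct_ext {ι : Type} [Fintype ι] {G : ι → C} {X : Tower C}
    {x y : ColimHom X (⨁ G)}
    (h : ∀ i, ColimHom.push X (biproduct.π G i) x = ColimHom.push X (biproduct.π G i) y) :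
    x = y := by
  rw [← ColimHom.push_id x, ← ColimHom.push_id y, ← biproduct.total, ColimHom.push_sum,
    ColimHom.push_sum]
  refine Finset.sum_congr rfl fun i _ => ?_
  rw [← ColimHom.push_push, h, ColimHom.push_push]

/-- The map to a biproduct with given components. -/
def ColimHom.biproductLift {ι : Type} [Fintype ι] {G : ι → C} {X : Tower C}
    (y : ∀ i, ColimHom X (G i)) : ColimHom X (⨁ G) :=
  ∑ i, ColimHom.push X (biproduct.ι G i) (y i)

lemma ColimHom.push_biproductLift {ι : Type} [Fintype ι] {G : ι → C} {X : Tower C}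
    (y : ∀ i, ColimHom X (G i)) (i : ι) :
    ColimHom.push X (biproduct.π G i) (biproductLift y) = y i := by
  classical
  rw [biproductLift, map_sum, Finset.sum_eq_single i]
  · rw [ColimHom.push_push, biproduct.ι_π_self, ColimHom.push_id]
  · intro j _ hj
    rw [ColimHom.push_push, biproduct.ι_π_ne _ hj, ColimHom.push_zero]
  · simp

/-- The inverse system of the products `∏_{k ≤ n} Fₖ`. -/
def prodTower (F : ℕ+ → C) : Tower C where
  obj n := ⨁ fun k : Set.Iic n.unop => F k.1
  map {n m} e := biproduct.lift fun k : Set.Iic m.unop =>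
    biproduct.π (fun k : Set.Iic n.unop => F k.1) ⟨k.1, le_trans k.2 (leOfHom e.unop)⟩
  map_id n := biproduct.hom_ext _ _ fun k => by simp
  map_comp e e' := biproduct.hom_ext _ _ fun k => by simp

/-- The projections of `prodTower`. -/
def prodTowerπ (F : ℕ+ → C) (n : ℕ+) (k : Set.Iic n) : (prodTower F).obj (op n) ⟶ F k.1 :=
  biproduct.π (fun k : Set.Iic n => F k.1) k

lemma prodTower_map_π (F : ℕ+ → C) {m n : ℕ+} (h : m ≤ n) (k : Set.Iic m) :
    (prodTower F).map (homOfLE h).op ≫ prodTowerπ F m k = prodTowerπ F n ⟨k.1, k.2.trans h⟩ :=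
  biproduct.lift_π _ _

/-- The map to `prodTower` with given components. -/
def prodTowerLift {X : Tower C} {F : ℕ+ → C} (y : ∀ k, ColimHom X (F k)) :
    proHom X (prodTower F) :=
  ⟨fun n => ColimHom.biproductLift fun k : Set.Iic n => y k.1, fun m n h => by
    refine ColimHom.biproduct_ext fun k => ?_
    refine (ColimHom.push_push _ _ _).trans ?_
    refine (congrArg (fun g => ColimHom.push X g _) (prodTower_map_π F h k)).trans ?_
    exact (ColimHom.push_biproductLift (fun k : Set.Iic n => y k.1) ⟨k.1, k.2.trans h⟩).trans
      (ColimHom.push_biproductLift (fun k : Set.Iic m => y k.1) k).symm⟩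

lemma push_prodTowerLift {X : Tower C} {F : ℕ+ → C} (y : ∀ k, ColimHom X (F k)) (n : ℕ+)
    (k : Set.Iic n) : ColimHom.push X (prodTowerπ F n k) ((prodTowerLift y).1 n) = y k.1 :=
  ColimHom.push_biproductLift _ _

variable (J : ObjectProperty C) (hJ : ∀ X : C, RelativelyInjective J X)

include hJ in
-- Since every object is relatively injective, all constant pro-objects are among the test objects
-- for cofibrations.
lemma exists_lift_of_isCofibration {X Y : ProObj C} {i : X ⟶ Y}
    (hi : IsCofibration (proBasic J) i) {c : C} (f : X ⟶ (constPro C).obj c) :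
    ∃ g : Y ⟶ (constPro C).obj c, i ≫ g = f :=
  hi _ ⟨c, hJ c, ⟨Iso.refl _⟩⟩ f

lemma isCofibration_of_exists_lift {X Y : ProObj C} {i : X ⟶ Y}
    (hi : ∀ {c : C} (f : X ⟶ (constPro C).obj c), ∃ g : Y ⟶ (constPro C).obj c, i ≫ g = f) :
    IsCofibration (proBasic J) i := by
  rintro I ⟨c, -, ⟨e⟩⟩ f
  obtain ⟨g, hg⟩ := hi (f ≫ e.inv)
  exact ⟨g ≫ e.hom, by simp [reassoc_of% hg]⟩

/-- The product of the constant pro-objects on the levels of a pro-object. -/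
def levelProd (F : ProObj C) : ProObj C := ⟨prodTower fun k => F.tower.obj (op k)⟩

/-- The canonical map from a pro-object to the product of its levels. -/
def toLevelProd (F : ProObj C) : F ⟶ levelProd F :=
  prodTowerLift fun k => ColimHom.mk k (𝟙 (F.tower.obj (op k)))

/-- A pro-object which is relatively injective is a retract of a countable product of constant
pro-objects. -/
lemma exists_retraction {F : ProObj C} (hF : RelativelyInjective (proBasic J) F) :
    ∃ r : levelProd F ⟶ F, toLevelProd F ≫ r = 𝟙 F := by
  -- Every map from `F` to a constant object factors through some level `F_n`, hence extends along
  -- the projection of the product to `F_n`. So the canonical map is a cofibration, and the identity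
  -- of `F` extends along it.
  refine hF _ (isCofibration_of_exists_lift J fun f => ?_) (𝟙 F)
  obtain ⟨n, f, rfl⟩ := toConst_surjective f
  refine ⟨toConst (ColimHom.mk n
      (prodTowerπ (fun k => F.tower.obj (op k)) n ⟨n, Set.self_mem_Iic⟩ ≫ f)),
    Subtype.ext (funext fun k => ?_)⟩
  change ColimHom.push F.tower
    (prodTowerπ (fun k => F.tower.obj (op k)) n ⟨n, Set.self_mem_Iic⟩ ≫ f)
    ((prodTowerLift fun k => ColimHom.mk k (𝟙 (F.tower.obj (op k)))).1 n) = ColimHom.mk n f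
  rw [← ColimHom.push_push, push_prodTowerLift, ColimHom.push_mk, Category.id_comp]

/-- The solutions found for the individual levels of `F` need not be compatible with the transition
maps, so they need not define a map to `F`. They do define a map to the product of the levels, and
the retraction turns it into a solution in `F`. -/
lemma exists_comp_eq_of_const {F : ProObj C} (hF : RelativelyInjective (proBasic J) F)
    {P Q : ProObj C} (d : P ⟶ Q) (x : P ⟶ F)
    (h : ∀ {c : C} (p : F ⟶ (constPro C).obj c), ∃ y : Q ⟶ (constPro C).obj c, d ≫ y = x ≫ p) :
    ∃ y : Q ⟶ F, d ≫ y = x := by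
  obtain ⟨r, hr⟩ := exists_retraction J hF
  choose y hy using fun k : ℕ+ => h (toConst (ColimHom.mk k (𝟙 (F.tower.obj (op k)))))
  let Y : Q ⟶ levelProd F :=
    prodTowerLift fun k => Subtype.val (show proHom Q.tower _ from y k) 1
  refine ⟨Y ≫ r, ?_⟩
  have e : d ≫ Y = x ≫ toLevelProd F := by
    refine Subtype.ext (funext fun n => ColimHom.biproduct_ext fun k => ?_)
    refine (push_proPrecomp (show proHom P.tower Q.tower from d) _ _).trans ?_
    refine Eq.trans ?_ (push_proPrecomp (show proHom P.tower F.tower from x) _ _).symm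
    refine (congrArg _ (push_prodTowerLift
      (fun k => Subtype.val (show proHom Q.tower _ from y k) 1) n k)).trans
      (Eq.trans ?_ (congrArg _ (push_prodTowerLift
        (fun k => ColimHom.mk k (𝟙 (F.tower.obj (op k)))) n k).symm))
    exact congrFun (congrArg Subtype.val (hy k.1)) 1
  rw [reassoc_of% e, hr, Category.comp_id]

end ProductTower

/-! ### `H`-unitality from linear splittings. -/

section Main

variable {C : Type u} [Category.{v} C] [Preadditive C] [HasFiniteBiproducts C]
  [MonoidalCategory C] [MonoidalPreadditive C]

theorem ProAlg.isHUnital_of_isLinearSplitting (J : ObjectProperty C) {B : ProAlg C}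
    (hB : ∀ n : ℕ+, ∃ (m : ℕ+) (e : op m ⟶ op n) (σ : _), Alg.IsLinearSplitting (B.map e) σ) :
    B.toAlg.IsHUnital (proBasic J) := by
  intro V F hF n x hx
  have hd : ∀ n, (((tensorLeft V).mapHomologicalComplex _).obj B.toAlg.bar).d (n + 1) n =
      V ◁ B.toAlg.barD n := fun n =>
    congrArg (fun f => V ◁ f) (ChainComplex.of_d _ _ n)
  rw [HomologicalComplex.dTo_eq _ (show (ComplexShape.down ℕ).Rel (n + 1) n from rfl),
    Category.assoc, Preadditive.IsIso.comp_left_eq_zero, hd] at hx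
  have hxp {c : C} (p : F ⟶ (constPro C).obj c) : V ◁ B.toAlg.barD n ≫ x ≫ p = 0 :=
    (Category.assoc _ _ _).symm.trans ((congrArg (· ≫ p) hx).trans zero_comp)
  cases n with
  | zero =>
    -- No differential leaves degree zero, so exactness there means that `x` vanishes; this is
    -- tested against constant objects, with `0` as witness.
    refine exists_comp_eq_of_const J hF _ x fun p => ⟨0, ?_⟩
    rw [comp_zero]
    exact (ProAlg.eq_zero_of_barD_zero V hB (x ≫ p) (hxp p)).symm
  | succ n =>
    rw [HomologicalComplex.dFrom_eq _ (show (ComplexShape.down ℕ).Rel (n + 1) n from rfl), hd]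
    obtain ⟨y, hy⟩ := exists_comp_eq_of_const J hF (V ◁ B.toAlg.barD n) x fun p =>
      ProAlg.exists_barD_comp_eq V hB (x ≫ p) (hxp p)
    exact ⟨(HomologicalComplex.xNextIso _
      (show (ComplexShape.down ℕ).Rel (n + 1) n from rfl)).hom ≫ y, (Category.assoc _ _ _).trans
      ((congrArg (V ◁ B.toAlg.barD n ≫ ·) (Iso.inv_hom_id_assoc _ _)).trans hy)⟩

end Main

end CQ

end

theorem theorem6p3 {C : Type u} [Category.{v} C]
    -- an additive category closed under finite limits and colimits
    [Preadditive C] [HasBinaryBiproducts C] [HasFiniteLimits C] [HasFiniteColimits C]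
    -- with a symmetric, additive tensor product which preserves cokernels
    [MonoidalCategory C] [SymmetricCategory C] [MonoidalPreadditive C]
    [∀ (X : C) ⦃Y Z : C⦄ (f : Y ⟶ Z), PreservesColimit (parallelPair f 0) (tensorLeft X)]
    -- and with a class `J` of basic objects for which every object is relatively injective
    (J : ObjectProperty C) (hJ : ∀ X : C, RelativelyInjective J X)
    (A K : ProAlg C) (hA : A.toAlg.IsQuasiFree)
    (i : K ⟶ A) (hi : ProAlg.IsProIdeal i)
    (hcof : IsCofibration (proBasic J) (ProAlg.toProHom i)) :
    K.infPower.toAlg.IsHUnital (proBasic J) ∧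
      IsCofibration (proBasic J) (ProAlg.toProHom K.infPowerIncl) := by
  have : HasFiniteBiproducts C := HasFiniteBiproducts.of_hasFiniteProducts
  -- The cofibration hypothesis is used only to extend the maps `K → K_n` represented by identities.
  have hK := fun n => ProAlg.exists_isPartialSplitting hA i hi n
    (exists_lift_of_isCofibration J hJ hcof _)
  exact ⟨ProAlg.isHUnital_of_isLinearSplitting J (ProAlg.exists_isLinearSplitting hK),
    isCofibration_of_exists_lift J fun g => ProAlg.exists_infPowerIncl_comp hK g⟩
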